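/- Notation. Let $\mathbb D=\{|z|<1\}$, $\mathbb T=\partial\mathbb D$, $\mathbb H=\{\operatorname{Im} w>0\}$. For $\beta>-1$, $A^2_\beta(\mathbb D^2)$ is the space of holomorphic $f$ on $\mathbb D^2$ with $$\|f\|^2=\int_{\mathbb D^2}|f(z)|^2(1-|z_1|^2)^\beta(1-|z_2|^2)^\beta\,dA(z_1)\,dA(z_2)<\infty,\qquad dA=\tfrac1\pi\,dx\,dy,$$ and $A^2_{-1}(\mathbb D^2)=H^2(\mathbb D^2)$ is the Hardy space, $\|f\|^2=\sup_{0<r<1}\frac1{4\pi^2}\int_{[0,2\pi]^2}|f(re^{i\theta_1},re^{i\theta_2})|^2\,d\theta_1\,d\theta_2$. For $p\in\mathbb C[z_1,z_2]$ of bidegree $(n,m)$ put $\widetilde p(z)=z_1^nz_2^m\,\overline{p(1/\overline{z_1},1/\overline{z_2})}$ and, for fixed $\tau=(\tau_1,\tau_2)\in\mathbb T^2$, let $$q(w)=(1-iw_1)^n(1-iw_2)^m\,p\Big(\tau_1\tfrac{1+iw_1}{1-iw_1},\ \tau_2\tfrac{1+iw_2}{1-iw_2}\Big)$$ be the corresponding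 polynomial on $\mathbb H^2$ (each map $w_k\mapsto\tau_k\frac{1+iw_k}{1-iw_k}$ takes $\mathbb H$ onto $\mathbb D$ and $0$ to $\tau_k$). Write $\overline q(w)=\overline{q(\overline{w_1},\overline{w_2})}$. A Weierstrass–Puiseux expansion of a polynomial $F(w_1,w_2)$ is a factorization, valid near $(0,0)$, $$F(w)=u(w)\,w_2^{k}\prod_{j=1}^{J}\big(w_1+g_j(w_2^{1/N})\big),$$ where $k,J\ge0$ and $N\ge1$ are integers, $u$ is analytic near $(0,0)$ with $u(0,0)\ne0$, and each $g_j$ is analytic near $0$ with $g_j(0)=0$ (precisely: the identity holds with $w_2=t^N$, $w_2^{1/N}=t$, for all $(w_1,t)$ near $(0,0)$). Two polynomials share a common factor in their Weierstrass–Puiseux expansions if, for some $N\ge 1$, they have such expansions with the same $N$ in which a common branch $w_1+g(w_2^{1/N})$ occurs, or in both of which the factor $w_2$ occurs. Statement. Let $p_1,p_2\in\mathbb C[z_1,z_2]$ be nonconstant polynomials without zeros in $\mathbb D^2$, with $p_\ell$ and $\widetilde p_\ell$ having no nonconstant common factor ($\ell=1,2$). Let $\phi_\ell=\widetilde p_\ell/p_\ell$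 be the induced rational inner functions, $\Phi=(\phi_1,\phi_2)$, let $\tau\in\mathbb T^2$ and let $q_1,q_2$ be the polynomials corresponding to $p_1,p_2$. If for some $(\alpha_1,\alpha_2)\in\mathbb T^2$ the polynomials $\overline{q_1}-\alpha_1q_1$ and $\overline{q_2}-\alpha_2q_2$ share a common factor in their Weierstrass–Puiseux expansions, then for every real $\beta\ge-1$ the composition operator $C_\Phi f=f\circ\Phi$ is not bounded from $A^2_\beta(\mathbb D^2)$ to itself. -/

import Mathlib

open scoped ENNReal NNReal Topology

noncomputable section

namespace RIFComposition

/-! ### The bidisc, weighted Bergman spaces, composition operators -/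

/-- The unit bidisc. -/
def bidisc : Set (ℂ × ℂ) := {z | ‖z.1‖ < 1 ∧ ‖z.2‖ < 1}

/-- The square of the norm of `A²_β`: for `β ≠ -1` the integral of
`|f|² (1-|z₁|²)^β (1-|z₂|²)^β` over the bidisc against the product of the normalized area
measures; for `β = -1` the Hardy space `H²`, with the supremum of the integral means over
the tori of radius `r < 1`. -/
def normSq (β : ℝ) (f : ℂ × ℂ → ℂ) : ℝ≥0∞ :=
  if β = -1 then
    ⨆ r ∈ Set.Ioo (0 : ℝ) 1,
      ENNReal.ofReal (1 / (2 * Real.pi) ^ 2) *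
        ∫⁻ θ in Set.Ioc (0 : ℝ) (2 * Real.pi) ×ˢ Set.Ioc (0 : ℝ) (2 * Real.pi),
          ‖f (r * Complex.exp (θ.1 * Complex.I), r * Complex.exp (θ.2 * Complex.I))‖ₑ ^ 2
  else
    ENNReal.ofReal (1 / Real.pi ^ 2) *
      ∫⁻ z in bidisc,
        ‖f z‖ₑ ^ 2 * ENNReal.ofReal ((1 - ‖z.1‖ ^ 2) ^ β * (1 - ‖z.2‖ ^ 2) ^ β)

/-- The norm of `A²_β`, with values in `[0, ∞]`. -/
def norm (β : ℝ) (f : ℂ × ℂ → ℂ) : ℝ≥0∞ := normSq β f ^ (1 / 2 : ℝ)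

/-- `A²_β(𝔻²)`: holomorphic functions on the bidisc of finite norm. -/
def bergmanSpace (β : ℝ) : Set (ℂ × ℂ → ℂ) :=
  {f | DifferentiableOn ℂ f bidisc ∧ norm β f < ∞}

/-- `f ↦ f ∘ Φ` is a bounded operator from `A²_β(𝔻²)` to itself. -/
def CompositionBounded (β : ℝ) (Φ : ℂ × ℂ → ℂ × ℂ) : Prop :=
  ∃ C : ℝ≥0, ∀ f ∈ bergmanSpace β,
    f ∘ Φ ∈ bergmanSpace β ∧ norm β (f ∘ Φ) ≤ C * norm β f

/-! ### Rational inner functions -/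

/-- The value of a polynomial in two variables at a point of `ℂ²`. -/
def evalAt (p : MvPolynomial (Fin 2) ℂ) (z : ℂ × ℂ) : ℂ := MvPolynomial.eval ![z.1, z.2] p

/-- The reflection `p̃(z) = z₁ⁿ z₂ᵐ conj (p (1 / conj z₁, 1 / conj z₂))`, where `(n, m)` is the
bidegree of `p`; this is again a polynomial. -/
def reflection (p : MvPolynomial (Fin 2) ℂ) : MvPolynomial (Fin 2) ℂ :=
  ∑ s ∈ p.support,
    MvPolynomial.C (starRingEnd ℂ (p.coeff s)) *
      MvPolynomial.X 0 ^ (p.degreeOf 0 - s 0) * MvPolynomial.X 1 ^ (p.degreeOf 1 - s 1)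

/-- `p` is a denominator inducing a nonconstant rational inner function `p̃ / p` in lowest terms:
`p` is stable (no zeros in the bidisc), not a constant, and has no nontrivial factor in common
with its reflection. -/
structure InducesRIF (p : MvPolynomial (Fin 2) ℂ) : Prop where
  stable : ∀ z ∈ bidisc, evalAt p z ≠ 0
  nonconstant : ∀ c : ℂ, p ≠ MvPolynomial.C c
  coprime : IsRelPrime p (reflection p)

/-- The rational inner function `p̃ / p`. -/
def rif (p : MvPolynomial (Fin 2) ℂ) (z : ℂ × ℂ) : ℂ := evalAt (reflection p) z / evalAt p z

/-! ### Passing to the bi-upper half-plane -/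

/-- The polynomial `q` corresponding to `p` under the Cayley transforms
`w_k ↦ τ_k (1 + i w_k) / (1 - i w_k)` (from the upper half-plane onto the disc, `0 ↦ τ_k`), i.e.
`q(w) = (1 - i w₁)ⁿ (1 - i w₂)ᵐ p (τ₁ (1 + i w₁) / (1 - i w₁), τ₂ (1 + i w₂) / (1 - i w₂))`,
`(n, m)` the bidegree of `p`. -/
def cayley (τ₁ τ₂ : Circle) (p : MvPolynomial (Fin 2) ℂ) : MvPolynomial (Fin 2) ℂ :=
  ∑ s ∈ p.support,
    MvPolynomial.C (p.coeff s * (τ₁ : ℂ) ^ s 0 * (τ₂ : ℂ) ^ s 1) *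
      ((1 + MvPolynomial.C Complex.I * MvPolynomial.X 0) ^ s 0 *
        (1 - MvPolynomial.C Complex.I * MvPolynomial.X 0) ^ (p.degreeOf 0 - s 0)) *
      ((1 + MvPolynomial.C Complex.I * MvPolynomial.X 1) ^ s 1 *
        (1 - MvPolynomial.C Complex.I * MvPolynomial.X 1) ^ (p.degreeOf 1 - s 1))

/-- The reflection `q̄(w) = conj (q (conj w₁, conj w₂))` for the half-plane: conjugate the
coefficients. -/
def conjPoly (q : MvPolynomial (Fin 2) ℂ) : MvPolynomial (Fin 2) ℂ :=
  MvPolynomial.map (starRingEnd ℂ) q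

/-! ### Weierstrass–Puiseux expansions at the origin -/

/-- A Weierstrass–Puiseux expansion of `F` near `(0, 0)` in powers of `w₂^{1/N}`:
`F(w) = u(w) w₂ᵏ ∏ⱼ (w₁ + gⱼ(w₂^{1/N}))`, with `u` analytic and nonvanishing at the origin and
each `gⱼ` analytic near `0` with `gⱼ(0) = 0`. The identity is written in the uniformizing
variable `t`, `w₂ = t^N`. Constant factors are absorbed in `u`; the power `w₂ᵏ` appears only if
the line `w₂ = 0` lies in the zero set of `F`. Branches
`w₁ + q(w₂) + w₂^{2L} ψ(w₂)` are the case `N = 1`, `g = q + t^{2L} ψ`. -/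
structure WPExpansion (F : MvPolynomial (Fin 2) ℂ) (N : ℕ) where
  u : ℂ × ℂ → ℂ
  u_analytic : AnalyticAt ℂ u (0, 0)
  u_ne_zero : u (0, 0) ≠ 0
  k : ℕ
  n : ℕ
  g : Fin n → ℂ → ℂ
  g_analytic : ∀ j, AnalyticAt ℂ (g j) 0
  g_zero : ∀ j, g j 0 = 0
  factorization : ∀ᶠ x : ℂ × ℂ in 𝓝 (0, 0),
    evalAt F (x.1, x.2 ^ N) = u (x.1, x.2 ^ N) * (x.2 ^ N) ^ k * ∏ j, (x.1 + g j x.2)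

/-- `F₁` and `F₂` share a factor in their Weierstrass–Puiseux expansions: a branch
`w₁ + g(w₂^{1/N})`, or the line factor `w₂`. Any two expansions can be written with a common
`N`. -/
def ShareWPFactor (F₁ F₂ : MvPolynomial (Fin 2) ℂ) : Prop :=
  ∃ N : ℕ, 0 < N ∧ ∃ (E₁ : WPExpansion F₁ N) (E₂ : WPExpansion F₂ N),
    (∃ i j, E₁.g i =ᶠ[𝓝 0] E₂.g j) ∨ (0 < E₁.k ∧ 0 < E₂.k)

end RIFComposition

end

open scoped ENNReal NNReal Topology

noncomputable section

namespace RIFComposition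

/-! ### Common zeros of coprime polynomials in two variables -/

/-! Under the Cayley transform the zero set of `q̄ - α q` becomes a level set `p̃ = λ p` with `λ = α
τ₁ⁿ τ₂ᵐ` unimodular. A shared factor therefore gives one curve on which both `φ₁` and `φ₂` take
constant unimodular values `λ₁`, `λ₂`.

This curve can be taken in the torus. Since `|φ| < 1` on the bidisc, `q̄ - α q` has no zeros in the
product of upper half-planes, and by conjugation none in the product of lower ones. A branch with
nonreal `w₁` at a real parameter could be perturbed into one of these products
(`eventually_im_branch_eq_zero`). Coprimality of `p` and `p̃` allows only finitely many values for
each coordinate of a common zero, so the denominators do not vanish on the curve close to, but away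
from, the base point. There the `φ`'s are Lipschitz, so `|φ_ℓ - λ_ℓ| ≤ L δ` on a `δ`-neighbourhood
of a short arc (`NearlyConstantAlongCurve`).

The test function is `∏ (1 - (1 - δ) conj λ_ℓ z_ℓ)⁻ˢ` with `s` large. It concentrates at one point
of the torus, and its squared norm is at most a constant times `δ^(2β + 4 - 4s)`
(`exists_normSq_biPeak_le`). Composed with `Φ` it has squared modulus at least of order `δ^(-4s)`
near a whole arc, whose neighbourhood has mass of order `δ^(2β + 3)` (`le_normSq_of_curve`). One
power of `δ` is lost because a curve replaces a point, so the ratio of squared norms is at least of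
order `1/δ` and is unbounded. -/

open Polynomial in
theorem isCoprime_map_of_isRelPrime {R : Type*} [CommRing R] [IsDomain R] [IsGCDMonoid R]
    {f g : R[X]} (h : IsRelPrime f g) :
    IsCoprime (f.map (algebraMap R (FractionRing R))) (g.map (algebraMap R (FractionRing R))) := by
  have := Classical.arbitrary (NormalizedGCDMonoid R)
  have hinj := IsFractionRing.injective R (FractionRing R)
  apply IsRelPrime.isCoprime
  intro d hf hg
  -- Gauss's lemma: after clearing denominators, the common divisor `d` is associated over the
  -- fraction field to a primitive polynomial over `R`, and a primitive polynomial dividing `f` and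
  -- `g` over the fraction field divides them over `R`.
  obtain ⟨b, hb0, hb⟩ := IsLocalization.integerNormalization_spec (nonZeroDivisors R) d
  set e := IsLocalization.integerNormalization (nonZeroDivisors R) d with he
  have hb0' : algebraMap R (FractionRing R) b ≠ 0 := by
    rw [Ne, FaithfulSMul.algebraMap_eq_zero_iff]; exact nonZeroDivisors.ne_zero hb0
  by_cases hd : d = 0
  · subst hd
    rw [zero_dvd_iff, Polynomial.map_eq_zero_iff hinj] at hf hg
    subst hf hg
    exact absurd (h dvd_rfl dvd_rfl) not_isUnit_zero
  have he0 : e ≠ 0 := by rwa [he, Ne, IsFractionRing.integerNormalization_eq_zero_iff]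
  have hmap : C (algebraMap R (FractionRing R) b) * d =
      C (algebraMap R (FractionRing R) e.content) * e.primPart.map (algebraMap R _) := by
    conv_rhs => rw [← Polynomial.map_C, ← Polynomial.map_mul, ← e.eq_C_content_mul_primPart, hb,
      Algebra.smul_def, Polynomial.algebraMap_apply]
  have hc0 : algebraMap R (FractionRing R) e.content ≠ 0 := by
    rw [Ne, FaithfulSMul.algebraMap_eq_zero_iff, content_eq_zero_iff]; exact he0
  have hu1 : IsUnit (C (algebraMap R (FractionRing R) b)) := (isUnit_C).2 hb0'.isUnit
  have hu2 : IsUnit (C (algebraMap R (FractionRing R) e.content)) := (isUnit_C).2 hc0.isUnit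
  have hdvd : e.primPart.map (algebraMap R (FractionRing R)) ∣ d := by
    rw [← hu1.dvd_mul_left, hmap]; exact dvd_mul_left _ _
  have hdvd' : d ∣ e.primPart.map (algebraMap R (FractionRing R)) := by
    rw [← hu2.dvd_mul_left, ← hmap]; exact dvd_mul_left _ _
  have hprim := e.isPrimitive_primPart
  have h1 := hprim.dvd_of_fraction_map_dvd_fraction_map (hdvd.trans hf)
  have h2 := hprim.dvd_of_fraction_map_dvd_fraction_map (hdvd.trans hg)
  exact isUnit_of_dvd_unit hdvd' ((h h1 h2).map (Polynomial.mapRingHom _))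

-- A Bézout identity over the fraction field, with denominators cleared; `d` plays the part of a
-- resultant.
open Polynomial in
theorem exists_mul_add_mul_eq_C_of_isRelPrime {R : Type*} [CommRing R] [IsDomain R]
    [IsGCDMonoid R] {f g : R[X]} (h : IsRelPrime f g) :
    ∃ a b : R[X], ∃ d : R, d ≠ 0 ∧ a * f + b * g = C d := by
  obtain ⟨a, b, hab⟩ := isCoprime_map_of_isRelPrime h
  obtain ⟨c, hc0, hc⟩ := IsLocalization.integerNormalization_spec (nonZeroDivisors R) a
  obtain ⟨e, he0, he⟩ := IsLocalization.integerNormalization_spec (nonZeroDivisors R) b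
  refine ⟨C e * IsLocalization.integerNormalization (nonZeroDivisors R) a,
    C c * IsLocalization.integerNormalization (nonZeroDivisors R) b, e * c,
    mul_ne_zero (nonZeroDivisors.ne_zero he0) (nonZeroDivisors.ne_zero hc0), ?_⟩
  apply map_injective (algebraMap R (FractionRing R)) (IsFractionRing.injective _ _)
  rw [Algebra.smul_def, Polynomial.algebraMap_apply] at hc he
  simp only [Polynomial.map_add, Polynomial.map_mul, map_C, map_mul, hc, he]
  linear_combination (C (algebraMap R (FractionRing R) e) *
    C (algebraMap R (FractionRing R) c)) * hab

/-- View the polynomials as univariate over `ℂ[y]`. The Bézout constant `d` is a nonzero polynomial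
in `y` that vanishes at the second coordinate of every common zero. -/
theorem finite_setOf_common_zero_snd {p q : MvPolynomial (Fin 2) ℂ} (h : IsRelPrime p q) :
    {y : ℂ | ∃ x, evalAt p (x, y) = 0 ∧ evalAt q (x, y) = 0}.Finite := by
  have h' : IsRelPrime (MvPolynomial.finSuccEquiv ℂ 1 p) (MvPolynomial.finSuccEquiv ℂ 1 q) := by
    apply IsRelPrime.of_map (MvPolynomial.finSuccEquiv ℂ 1).symm
    simpa using h
  obtain ⟨a, b, d, hd, hab⟩ := exists_mul_add_mul_eq_C_of_isRelPrime h'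
  by_contra hinf
  apply hd
  apply MvPolynomial.funext_set
    (fun _ => {y : ℂ | ∃ x, evalAt p (x, y) = 0 ∧ evalAt q (x, y) = 0}) (fun _ => hinf)
  intro s hs
  obtain ⟨x, hx1, hx2⟩ := hs 0 trivial
  have hs' : (![x, s 0] : Fin 2 → ℂ) = Fin.cons x s := by
    ext i; fin_cases i <;> rfl
  rw [evalAt, hs', MvPolynomial.eval_eq_eval_mv_eval'] at hx1 hx2
  have := congrArg (fun r => Polynomial.eval x (Polynomial.map (MvPolynomial.eval s) r)) hab
  simp only [Polynomial.map_add, Polynomial.map_mul, Polynomial.eval_add, Polynomial.eval_mul,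
    hx1, hx2, mul_zero, add_zero, Polynomial.map_C, Polynomial.eval_C] at this
  rw [← this, map_zero]

theorem finite_setOf_common_zero_fst {p q : MvPolynomial (Fin 2) ℂ} (h : IsRelPrime p q) :
    {x : ℂ | ∃ y, evalAt p (x, y) = 0 ∧ evalAt q (x, y) = 0}.Finite := by
  have h' : IsRelPrime (MvPolynomial.renameEquiv ℂ (Equiv.swap (0 : Fin 2) 1) p)
      (MvPolynomial.renameEquiv ℂ (Equiv.swap (0 : Fin 2) 1) q) := by
    apply IsRelPrime.of_map (MvPolynomial.renameEquiv ℂ (Equiv.swap (0 : Fin 2) 1)).symm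
    rwa [AlgEquiv.symm_apply_apply, AlgEquiv.symm_apply_apply]
  have key : ∀ (r : MvPolynomial (Fin 2) ℂ) (x y : ℂ),
      evalAt (MvPolynomial.renameEquiv ℂ (Equiv.swap (0 : Fin 2) 1) r) (y, x) =
        evalAt r (x, y) := by
    intro r x y
    simp only [evalAt, MvPolynomial.renameEquiv_apply, MvPolynomial.eval_rename]
    congr 2
    ext i; fin_cases i <;> simp
  simpa only [key] using finite_setOf_common_zero_snd h'

/-! ### Polynomials without zeros in the bidisc and their reflections -/

theorem evalAt_eq_sum (p : MvPolynomial (Fin 2) ℂ) (z : ℂ × ℂ) :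
    evalAt p z = ∑ s ∈ p.support, p.coeff s * (z.1 ^ s 0 * z.2 ^ s 1) := by
  simp [evalAt, MvPolynomial.eval_eq', Fin.prod_univ_two]

theorem differentiable_evalAt (p : MvPolynomial (Fin 2) ℂ) : Differentiable ℂ (evalAt p) := by
  have : evalAt p = fun z => ∑ s ∈ p.support, p.coeff s * (z.1 ^ s 0 * z.2 ^ s 1) :=
    funext (evalAt_eq_sum p)
  rw [this]
  fun_prop

theorem continuous_evalAt (p : MvPolynomial (Fin 2) ℂ) : Continuous (evalAt p) :=
  (differentiable_evalAt p).continuous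

theorem analyticAt_evalAt (p : MvPolynomial (Fin 2) ℂ) (z : ℂ × ℂ) :
    AnalyticAt ℂ (evalAt p) z := by
  have : evalAt p = fun z => ∑ s ∈ p.support, p.coeff s * (z.1 ^ s 0 * z.2 ^ s 1) :=
    funext (evalAt_eq_sum p)
  rw [this]
  exact Finset.analyticAt_fun_sum _ fun s _ =>
    analyticAt_const.mul ((analyticAt_fst.pow _).mul (analyticAt_snd.pow _))

/-- The reflection of the dilated polynomial `p (r z)`, as a function. -/
def dilatedReflection (p : MvPolynomial (Fin 2) ℂ) (r : ℝ) (z : ℂ × ℂ) : ℂ :=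
  ∑ s ∈ p.support, starRingEnd ℂ (p.coeff s) * (r : ℂ) ^ (s 0 + s 1) *
    z.1 ^ (p.degreeOf 0 - s 0) * z.2 ^ (p.degreeOf 1 - s 1)

theorem dilatedReflection_one (p : MvPolynomial (Fin 2) ℂ) (z : ℂ × ℂ) :
    dilatedReflection p 1 z = evalAt (reflection p) z := by
  simp [dilatedReflection, evalAt, reflection]

theorem le_degreeOf_of_mem_support {p : MvPolynomial (Fin 2) ℂ} {s : Fin 2 →₀ ℕ}
    (hs : s ∈ p.support) (i : Fin 2) : s i ≤ p.degreeOf i := by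
  classical
  exact MvPolynomial.monomial_le_degreeOf i hs

theorem pow_sub_eq_mul_conj_pow {z : ℂ} (hz : ‖z‖ = 1) {n s : ℕ} (h : s ≤ n) :
    z ^ (n - s) = z ^ n * (starRingEnd ℂ z) ^ s := by
  have h1 : z * starRingEnd ℂ z = 1 := by
    rw [Complex.mul_conj, Complex.normSq_eq_norm_sq, hz]; simp
  obtain ⟨k, rfl⟩ := Nat.exists_eq_add_of_le h
  rw [Nat.add_sub_cancel_left, pow_add]
  calc z ^ k = (z * starRingEnd ℂ z) ^ s * z ^ k := by rw [h1, one_pow, one_mul]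
    _ = _ := by ring

theorem dilatedReflection_of_norm_eq_one (p : MvPolynomial (Fin 2) ℂ) (r : ℝ) {z : ℂ × ℂ}
    (h1 : ‖z.1‖ = 1) (h2 : ‖z.2‖ = 1) :
    dilatedReflection p r z = z.1 ^ p.degreeOf 0 * z.2 ^ p.degreeOf 1 *
      starRingEnd ℂ (evalAt p (r * z.1, r * z.2)) := by
  rw [dilatedReflection, evalAt_eq_sum, map_sum, Finset.mul_sum]
  refine Finset.sum_congr rfl fun s hs => ?_
  rw [pow_sub_eq_mul_conj_pow h1 (le_degreeOf_of_mem_support hs 0),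
    pow_sub_eq_mul_conj_pow h2 (le_degreeOf_of_mem_support hs 1)]
  simp only [map_mul, map_pow, Complex.conj_ofReal]
  ring

theorem norm_dilatedReflection_of_norm_eq_one (p : MvPolynomial (Fin 2) ℂ) (r : ℝ) {z : ℂ × ℂ}
    (h1 : ‖z.1‖ = 1) (h2 : ‖z.2‖ = 1) :
    ‖dilatedReflection p r z‖ = ‖evalAt p (r * z.1, r * z.2)‖ := by
  rw [dilatedReflection_of_norm_eq_one p r h1 h2]
  simp [h1, h2]

theorem differentiable_dilatedReflection (p : MvPolynomial (Fin 2) ℂ) (r : ℝ) :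
    Differentiable ℂ (dilatedReflection p r) := by
  unfold dilatedReflection
  fun_prop

/-- The maximum principle on the closed unit disc for quotients. -/
theorem norm_le_norm_of_forall_sphere {f g : ℂ → ℂ} (hf : Differentiable ℂ f)
    (hg : Differentiable ℂ g) (hg0 : ∀ z, ‖z‖ ≤ 1 → g z ≠ 0)
    (h : ∀ z, ‖z‖ = 1 → ‖f z‖ ≤ ‖g z‖) {z : ℂ} (hz : ‖z‖ ≤ 1) : ‖f z‖ ≤ ‖g z‖ := by
  have hcl : closure (Metric.ball (0 : ℂ) 1) = Metric.closedBall 0 1 :=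
    closure_ball _ one_ne_zero
  have hd : DiffContOnCl ℂ (fun z => f z / g z) (Metric.ball 0 1) := by
    apply DifferentiableOn.diffContOnCl
    rw [hcl]
    intro w hw
    exact ((hf w).div (hg w) (hg0 w (by simpa using hw))).differentiableWithinAt
  have := Complex.norm_le_of_forall_mem_frontier_norm_le (f := fun z => f z / g z)
    (U := Metric.ball 0 1) Metric.isBounded_ball hd (C := 1) (fun w hw => ?_) (z := z)
    (by rw [hcl]; simpa using hz)
  · rwa [norm_div, div_le_one (norm_pos_iff.2 (hg0 z hz))] at this
  · rw [frontier_ball _ one_ne_zero, mem_sphere_zero_iff_norm] at hw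
    rw [norm_div]
    exact div_le_one_of_le₀ (h w hw) (norm_nonneg _)

/-- Dilation makes the denominator zero-free on the closed bidisc, so the maximum principle applies
to the quotient in one variable at a time, starting from the torus, where the two moduli agree. -/
theorem norm_dilatedReflection_le {p : MvPolynomial (Fin 2) ℂ}
    (hp : ∀ z ∈ bidisc, evalAt p z ≠ 0) {r : ℝ} (hr0 : 0 < r) (hr1 : r < 1) {z : ℂ × ℂ}
    (hz1 : ‖z.1‖ ≤ 1) (hz2 : ‖z.2‖ ≤ 1) :
    ‖dilatedReflection p r z‖ ≤ ‖evalAt p (r * z.1, r * z.2)‖ := by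
  have hne : ∀ x y : ℂ, ‖x‖ ≤ 1 → ‖y‖ ≤ 1 → evalAt p (r * x, r * y) ≠ 0 := by
    have aux : ∀ x : ℂ, ‖x‖ ≤ 1 → ‖r * x‖ < 1 := by
      intro x hx
      rw [norm_mul, Complex.norm_real, Real.norm_of_nonneg hr0.le]
      nlinarith [norm_nonneg x]
    exact fun x y hx hy => hp _ ⟨aux x hx, aux y hy⟩
  have hd := differentiable_dilatedReflection p r
  have he := differentiable_evalAt p
  obtain ⟨x, y⟩ := z
  refine norm_le_norm_of_forall_sphere (f := fun w => dilatedReflection p r (x, w))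
    (g := fun w => evalAt p (r * x, r * w)) (by fun_prop) (by fun_prop)
    (fun w hw => hne _ _ hz1 hw) (fun w hw => ?_) hz2
  refine norm_le_norm_of_forall_sphere (f := fun v => dilatedReflection p r (v, w))
    (g := fun v => evalAt p (r * v, r * w)) (by fun_prop) (by fun_prop)
    (fun v hv => hne _ _ hv hw.le) (fun v hv => ?_) hz1
  exact (norm_dilatedReflection_of_norm_eq_one p r (z := (v, w)) hv hw).le

theorem norm_reflection_le {p : MvPolynomial (Fin 2) ℂ}
    (hp : ∀ z ∈ bidisc, evalAt p z ≠ 0) {z : ℂ × ℂ} (hz : z ∈ bidisc) :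
    ‖evalAt (reflection p) z‖ ≤ ‖evalAt p z‖ := by
  have h1 : Continuous fun r : ℝ => ‖dilatedReflection p r z‖ := by
    unfold dilatedReflection; fun_prop
  have h2 : Continuous fun r : ℝ => ‖evalAt p (r * z.1, r * z.2)‖ := by
    have := continuous_evalAt p
    fun_prop
  have h := le_of_tendsto_of_tendsto (h1.continuousWithinAt (s := Set.Iio 1) (x := 1))
    (h2.continuousWithinAt (s := Set.Iio 1) (x := 1)) ?_
  · simpa [dilatedReflection_one] using h
  · filter_upwards [Ioo_mem_nhdsLT (zero_lt_one (α := ℝ))] with r hr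
    exact norm_dilatedReflection_le hp hr.1 hr.2 hz.1.le hz.2.le

theorem isOpen_bidisc : IsOpen bidisc :=
  (isOpen_lt continuous_fst.norm continuous_const).inter
    (isOpen_lt continuous_snd.norm continuous_const)

theorem bidisc_eq : bidisc = Metric.ball (0 : ℂ) 1 ×ˢ Metric.ball (0 : ℂ) 1 := by
  ext z; simp [bidisc]

theorem differentiableOn_rif {p : MvPolynomial (Fin 2) ℂ}
    (hp : ∀ z ∈ bidisc, evalAt p z ≠ 0) : DifferentiableOn ℂ (rif p) bidisc := by
  intro z hz
  have := (differentiable_evalAt (reflection p) z).mul ((differentiable_evalAt p z).inv (hp z hz))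
  exact this.differentiableWithinAt

theorem InducesRIF.not_isUnit {p : MvPolynomial (Fin 2) ℂ} (hp : InducesRIF p) : ¬ IsUnit p := by
  intro h
  obtain ⟨c, -, hc⟩ := (MvPolynomial.isUnit_iff_eq_C_of_isReduced).1 h
  exact hp.nonconstant c hc

/-- Equality at an interior point would make `p̃ / p` constant by the strong maximum principle. Then
the nonunit `p` would divide `p̃`, against coprimality. -/
theorem InducesRIF.norm_rif_lt_one {p : MvPolynomial (Fin 2) ℂ} (hp : InducesRIF p) {z : ℂ × ℂ}
    (hz : z ∈ bidisc) : ‖rif p z‖ < 1 := by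
  have hle : ∀ w ∈ bidisc, ‖rif p w‖ ≤ 1 := fun w hw => by
    rw [rif, norm_div]
    exact div_le_one_of_le₀ (norm_reflection_le hp.stable hw) (norm_nonneg _)
  refine lt_of_le_of_ne (hle z hz) fun h1 => hp.not_isUnit ?_
  have hconn : IsPreconnected bidisc := by
    rw [bidisc_eq]
    exact ((convex_ball _ _).prod (convex_ball _ _)).isPreconnected
  have heq := Complex.eqOn_of_isPreconnected_of_isMaxOn_norm hconn isOpen_bidisc
    (differentiableOn_rif hp.stable) hz (fun w hw => by simpa [h1] using hle w hw)
  have hpoly : reflection p = MvPolynomial.C (rif p z) * p := by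
    apply MvPolynomial.funext_set (fun _ => Metric.ball (0 : ℂ) 1)
    · intro _
      exact infinite_of_mem_nhds 0 (Metric.ball_mem_nhds _ one_pos)
    · intro x hx
      have hx' : (x 0, x 1) ∈ bidisc := by
        rw [bidisc_eq]; exact ⟨hx 0 trivial, hx 1 trivial⟩
      have h2 := heq hx'
      rw [rif, div_eq_iff (hp.stable _ hx')] at h2
      have hxe : (![x 0, x 1] : Fin 2 → ℂ) = x := by ext i; fin_cases i <;> rfl
      simpa [evalAt, hxe] using h2
  exact hp.coprime dvd_rfl (hpoly ▸ dvd_mul_left _ _)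

/-! ### The Cayley transform -/

/-- The map `w ↦ (1 + i w) / (1 - i w)` from the upper half-plane to the disc. -/
def cayleyMap (w : ℂ) : ℂ := (1 + Complex.I * w) / (1 - Complex.I * w)

/-- The change of variables from the bi-upper half-plane to the bidisc. -/
def biCayley (τ₁ τ₂ : Circle) (w : ℂ × ℂ) : ℂ × ℂ := (τ₁ * cayleyMap w.1, τ₂ * cayleyMap w.2)

theorem evalAt_cayley (τ₁ τ₂ : Circle) (p : MvPolynomial (Fin 2) ℂ) {w : ℂ × ℂ}
    (h1 : 1 - Complex.I * w.1 ≠ 0) (h2 : 1 - Complex.I * w.2 ≠ 0) :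
    evalAt (cayley τ₁ τ₂ p) w = (1 - Complex.I * w.1) ^ p.degreeOf 0 *
      (1 - Complex.I * w.2) ^ p.degreeOf 1 * evalAt p (biCayley τ₁ τ₂ w) := by
  rw [evalAt_eq_sum p, Finset.mul_sum]
  simp only [cayley, evalAt, map_sum]
  refine Finset.sum_congr rfl fun s hs => ?_
  obtain ⟨k, hk⟩ := Nat.exists_eq_add_of_le (le_degreeOf_of_mem_support hs 0)
  obtain ⟨l, hl⟩ := Nat.exists_eq_add_of_le (le_degreeOf_of_mem_support hs 1)
  simp only [hk, hl, Nat.add_sub_cancel_left, biCayley, cayleyMap, map_mul, map_pow, map_add,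
    map_sub, map_one, MvPolynomial.eval_C, MvPolynomial.eval_X, Matrix.cons_val_zero,
    Matrix.cons_val_one, mul_pow, div_pow, pow_add]
  field_simp

theorem evalAt_conjPoly (q : MvPolynomial (Fin 2) ℂ) (w : ℂ × ℂ) :
    evalAt (conjPoly q) w =
      starRingEnd ℂ (evalAt q (starRingEnd ℂ w.1, starRingEnd ℂ w.2)) := by
  have h : (![w.1, w.2] : Fin 2 → ℂ) =
      starRingEnd ℂ ∘ ![starRingEnd ℂ w.1, starRingEnd ℂ w.2] := by
    ext i; fin_cases i <;> simp
  rw [evalAt, h, conjPoly, MvPolynomial.eval_map, evalAt, ← MvPolynomial.eval₂_id,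
    MvPolynomial.hom_eval₂, RingHom.comp_id]; rfl

/-- Conjugating coefficients exchanges `1 + i w` and `1 - i w`, which is reflection in the circle;
hence `q̄ / q` is `p̃ / p` up to the constant `conj (τ₁ⁿ τ₂ᵐ)`. -/
theorem evalAt_conjPoly_cayley (τ₁ τ₂ : Circle) (p : MvPolynomial (Fin 2) ℂ) {w : ℂ × ℂ}
    (h1 : 1 - Complex.I * w.1 ≠ 0) (h2 : 1 - Complex.I * w.2 ≠ 0) :
    evalAt (conjPoly (cayley τ₁ τ₂ p)) w = (1 - Complex.I * w.1) ^ p.degreeOf 0 *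
      (1 - Complex.I * w.2) ^ p.degreeOf 1 *
      (starRingEnd ℂ (τ₁ ^ p.degreeOf 0 * τ₂ ^ p.degreeOf 1 : ℂ) *
        evalAt (reflection p) (biCayley τ₁ τ₂ w)) := by
  have e1 : (starRingEnd ℂ (τ₁ : ℂ)) * τ₁ = 1 := by
    rw [mul_comm, Complex.mul_conj, Complex.normSq_eq_norm_sq, Circle.norm_coe]; simp
  have e2 : (starRingEnd ℂ (τ₂ : ℂ)) * τ₂ = 1 := by
    rw [mul_comm, Complex.mul_conj, Complex.normSq_eq_norm_sq, Circle.norm_coe]; simp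
  rw [evalAt_conjPoly, ← dilatedReflection_one, dilatedReflection, Finset.mul_sum, Finset.mul_sum]
  simp only [cayley, evalAt, map_sum]
  refine Finset.sum_congr rfl fun s hs => ?_
  obtain ⟨k, hk⟩ := Nat.exists_eq_add_of_le (le_degreeOf_of_mem_support hs 0)
  obtain ⟨l, hl⟩ := Nat.exists_eq_add_of_le (le_degreeOf_of_mem_support hs 1)
  simp only [hk, hl, Nat.add_sub_cancel_left, biCayley, cayleyMap, map_mul, map_pow, map_add,
    map_sub, map_one, MvPolynomial.eval_C, MvPolynomial.eval_X, Matrix.cons_val_zero,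
    Matrix.cons_val_one, Complex.conj_conj, Complex.conj_I]
  -- The contribution of a single variable to a monomial, with `conj t · t = 1` absorbing the powers
  -- of `τ`.
  have f1 : ∀ (t : ℂ), (starRingEnd ℂ t) * t = 1 → ∀ s k : ℕ, ∀ v : ℂ, 1 - Complex.I * v ≠ 0 →
      (1 - Complex.I * v) ^ (s + k) * ((starRingEnd ℂ t) ^ (s + k) *
        (t * ((1 + Complex.I * v) / (1 - Complex.I * v))) ^ k) =
      (starRingEnd ℂ t) ^ s * ((1 + -Complex.I * v) ^ s * (1 - -Complex.I * v) ^ k) := by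
    intro t ht s k v hv
    have e : (starRingEnd ℂ t) ^ (s + k) * t ^ k = (starRingEnd ℂ t) ^ s := by
      rw [pow_add, mul_assoc, ← mul_pow, ht, one_pow, mul_one]
    rw [mul_pow, div_pow, ← mul_assoc ((starRingEnd ℂ t) ^ (s + k)), e, pow_add]
    field_simp
    ring
  have g1 := f1 τ₁ e1 (s 0) k w.1 h1
  have g2 := f1 τ₂ e2 (s 1) l w.2 h2
  simp only [Complex.ofReal_one, one_pow, mul_one]
  calc _ = starRingEnd ℂ (p.coeff s) *
        ((starRingEnd ℂ (τ₁ : ℂ)) ^ s 0 * ((1 + -Complex.I * w.1) ^ s 0 *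
          (1 - -Complex.I * w.1) ^ k)) *
        ((starRingEnd ℂ (τ₂ : ℂ)) ^ s 1 * ((1 + -Complex.I * w.2) ^ s 1 *
          (1 - -Complex.I * w.2) ^ l)) := by ring
    _ = _ := by rw [← g1, ← g2]; ring

/-! ### Level curves of rational inner functions in the bi-upper half-plane -/

theorem one_sub_I_mul_ne_zero_of_im_nonneg {w : ℂ} (hw : 0 ≤ w.im) : 1 - Complex.I * w ≠ 0 := by
  intro h
  have := congrArg Complex.re h
  simp at this
  linarith

theorem norm_cayleyMap_lt_one {w : ℂ} (hw : 0 < w.im) : ‖cayleyMap w‖ < 1 := by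
  rw [cayleyMap, norm_div,
    div_lt_one (norm_pos_iff.2 (one_sub_I_mul_ne_zero_of_im_nonneg hw.le)),
    ← sq_lt_sq₀ (norm_nonneg _) (norm_nonneg _), Complex.sq_norm, Complex.sq_norm,
    Complex.normSq_apply, Complex.normSq_apply]
  simp
  nlinarith

/-- `(1 + i x) / √(1 + x²) = exp (i arctan x)`, and the Cayley map is the square of this. -/
theorem cayleyMap_ofReal (x : ℝ) :
    cayleyMap x = Complex.exp ((2 * Real.arctan x : ℝ) * Complex.I) := by
  have h0 : (0 : ℝ) < √(1 + x ^ 2) := Real.sqrt_pos.2 (by positivity)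
  have h1 : Complex.exp ((Real.arctan x : ℝ) * Complex.I) =
      (1 + Complex.I * x) / (√(1 + x ^ 2) : ℝ) := by
    rw [Complex.exp_mul_I, ← Complex.ofReal_cos, ← Complex.ofReal_sin, Real.cos_arctan,
      Real.sin_arctan]
    push_cast
    ring
  have h2 : ((√(1 + x ^ 2) : ℝ) : ℂ) ^ 2 = (1 + Complex.I * x) * (1 - Complex.I * x) := by
    rw [← Complex.ofReal_pow, Real.sq_sqrt (by positivity)]
    push_cast
    linear_combination ((x : ℂ) ^ 2) * Complex.I_sq
  have h3 : (1 : ℂ) - Complex.I * x ≠ 0 := one_sub_I_mul_ne_zero_of_im_nonneg (by simp)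
  have h4 : (1 : ℂ) + Complex.I * x ≠ 0 := by
    have := one_sub_I_mul_ne_zero_of_im_nonneg (w := -x) (by simp)
    simpa using this
  have h5 : ((2 * Real.arctan x : ℝ) : ℂ) * Complex.I =
      (Real.arctan x : ℝ) * Complex.I + (Real.arctan x : ℝ) * Complex.I := by push_cast; ring
  rw [h5, Complex.exp_add, h1, div_mul_div_comm, ← sq ((√(1 + x ^ 2) : ℝ) : ℂ), h2, cayleyMap]
  field_simp

theorem cayleyMap_inj {v w : ℂ} (hv : 1 - Complex.I * v ≠ 0) (hw : 1 - Complex.I * w ≠ 0)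
    (h : cayleyMap v = cayleyMap w) : v = w := by
  rw [cayleyMap, cayleyMap, div_eq_div_iff hv hw] at h
  have : (2 * Complex.I) * (v - w) = 0 := by linear_combination h
  simpa [sub_eq_zero] using this

/-- The function `q̄ - α q`, whose zero set corresponds to a level set of `p̃ / p`. -/
def levelPoly (τ₁ τ₂ α : Circle) (p : MvPolynomial (Fin 2) ℂ) : MvPolynomial (Fin 2) ℂ :=
  conjPoly (cayley τ₁ τ₂ p) - MvPolynomial.C (α : ℂ) * cayley τ₁ τ₂ p

/-- The value of the rational inner function on the zero set of `levelPoly τ₁ τ₂ α p`. -/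
def levelValue (τ₁ τ₂ α : Circle) (p : MvPolynomial (Fin 2) ℂ) : Circle :=
  α * (τ₁ ^ p.degreeOf 0 * τ₂ ^ p.degreeOf 1)

theorem evalAt_levelPoly_eq_zero_iff (τ₁ τ₂ α : Circle) (p : MvPolynomial (Fin 2) ℂ) {w : ℂ × ℂ}
    (h1 : 1 - Complex.I * w.1 ≠ 0) (h2 : 1 - Complex.I * w.2 ≠ 0) :
    evalAt (levelPoly τ₁ τ₂ α p) w = 0 ↔ evalAt (reflection p) (biCayley τ₁ τ₂ w) =
      levelValue τ₁ τ₂ α p * evalAt p (biCayley τ₁ τ₂ w) := by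
  have e : evalAt (levelPoly τ₁ τ₂ α p) w = evalAt (conjPoly (cayley τ₁ τ₂ p)) w -
      α * evalAt (cayley τ₁ τ₂ p) w := by simp [levelPoly, evalAt]
  have hT : starRingEnd ℂ (τ₁ ^ p.degreeOf 0 * τ₂ ^ p.degreeOf 1 : ℂ) *
      (τ₁ ^ p.degreeOf 0 * τ₂ ^ p.degreeOf 1 : ℂ) = 1 := by
    rw [mul_comm, Complex.mul_conj, Complex.normSq_eq_norm_sq]
    simp [Circle.norm_coe]
  rw [e, evalAt_cayley τ₁ τ₂ p h1 h2, evalAt_conjPoly_cayley τ₁ τ₂ p h1 h2]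
  set T := (τ₁ ^ p.degreeOf 0 * τ₂ ^ p.degreeOf 1 : ℂ) with hTdef
  have hv : (levelValue τ₁ τ₂ α p : ℂ) = α * T := by simp [levelValue, hTdef]
  set D := (1 - Complex.I * w.1) ^ p.degreeOf 0 * (1 - Complex.I * w.2) ^ p.degreeOf 1 with hD
  have hD0 : D ≠ 0 := mul_ne_zero (pow_ne_zero _ h1) (pow_ne_zero _ h2)
  rw [hv]
  constructor
  · intro h
    have h' : D * (starRingEnd ℂ T * evalAt (reflection p) (biCayley τ₁ τ₂ w) -
        α * evalAt p (biCayley τ₁ τ₂ w)) = 0 := by linear_combination h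
    have h3 := (mul_eq_zero.1 h').resolve_left hD0
    linear_combination T * h3 - evalAt (reflection p) (biCayley τ₁ τ₂ w) * hT
  · intro h
    rw [h]
    linear_combination (D * α * evalAt p (biCayley τ₁ τ₂ w)) * hT

/-- For `F = q̄ - α q` with `|α| = 1`, `conj (F (conj w)) = -conj α · F w`. -/
theorem evalAt_levelPoly_conj (τ₁ τ₂ α : Circle) (p : MvPolynomial (Fin 2) ℂ) {w : ℂ × ℂ}
    (h : evalAt (levelPoly τ₁ τ₂ α p) w = 0) :
    evalAt (levelPoly τ₁ τ₂ α p) (starRingEnd ℂ w.1, starRingEnd ℂ w.2) = 0 := by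
  have e : ∀ v, evalAt (levelPoly τ₁ τ₂ α p) v = evalAt (conjPoly (cayley τ₁ τ₂ p)) v -
      α * evalAt (cayley τ₁ τ₂ p) v := by simp [levelPoly, evalAt]
  have hα : starRingEnd ℂ (α : ℂ) * α = 1 := by
    rw [mul_comm, Complex.mul_conj, Complex.normSq_eq_norm_sq, Circle.norm_coe]; simp
  rw [e, evalAt_conjPoly] at h ⊢
  simp only [Complex.conj_conj, Prod.mk.eta]
  have h' := congrArg (starRingEnd ℂ) h
  simp only [map_sub, map_mul, Complex.conj_conj, map_zero] at h'
  linear_combination (-(α : ℂ)) * h' - starRingEnd ℂ (evalAt (cayley τ₁ τ₂ p) w) * hα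

theorem evalAt_levelPoly_ne_zero {p : MvPolynomial (Fin 2) ℂ} (hp : InducesRIF p)
    (τ₁ τ₂ α : Circle) {w : ℂ × ℂ} (h1 : 0 < w.1.im) (h2 : 0 < w.2.im) :
    evalAt (levelPoly τ₁ τ₂ α p) w ≠ 0 := by
  rw [Ne, evalAt_levelPoly_eq_zero_iff τ₁ τ₂ α p (one_sub_I_mul_ne_zero_of_im_nonneg h1.le)
    (one_sub_I_mul_ne_zero_of_im_nonneg h2.le)]
  intro h
  have hz : biCayley τ₁ τ₂ w ∈ bidisc := by
    refine ⟨?_, ?_⟩ <;> simp only [biCayley, norm_mul, Circle.norm_coe, one_mul]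
    exacts [norm_cayleyMap_lt_one h1, norm_cayleyMap_lt_one h2]
  have := hp.norm_rif_lt_one hz
  rw [rif, h, mul_div_cancel_right₀ _ (hp.stable _ hz), Circle.norm_coe] at this
  exact lt_irrefl _ this

theorem evalAt_levelPoly_ne_zero_of_im_neg {p : MvPolynomial (Fin 2) ℂ} (hp : InducesRIF p)
    (τ₁ τ₂ α : Circle) {w : ℂ × ℂ} (h1 : w.1.im < 0) (h2 : w.2.im < 0) :
    evalAt (levelPoly τ₁ τ₂ α p) w ≠ 0 := fun h =>
  evalAt_levelPoly_ne_zero hp τ₁ τ₂ α (w := (starRingEnd ℂ w.1, starRingEnd ℂ w.2))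
    (by simpa using h1) (by simpa using h2) (evalAt_levelPoly_conj τ₁ τ₂ α p h)

/-- Rotate `t` by a small angle `η < π / N`; the `N`-th power is rotated by `N η < π`. -/
theorem exists_mem_im_pow_pos {N : ℕ} (hN : 0 < N) {t : ℝ} (ht : 0 < t) {U : Set ℂ}
    (hU : U ∈ 𝓝 (t : ℂ)) : ∃ z ∈ U, 0 < (z ^ N).im := by
  have hc : Filter.Tendsto (fun η : ℝ => (t : ℂ) * Complex.exp (η * Complex.I)) (𝓝[>] 0)
      (𝓝 (t : ℂ)) := by
    have : Continuous fun η : ℝ => (t : ℂ) * Complex.exp (η * Complex.I) := by fun_prop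
    have h := this.tendsto 0
    simp only [Complex.ofReal_zero, zero_mul, Complex.exp_zero, mul_one] at h
    exact h.mono_left nhdsWithin_le_nhds
  have hpos : 0 < Real.pi / N := by positivity
  obtain ⟨η, h1, h2⟩ := ((hc.eventually hU).and (Ioo_mem_nhdsGT hpos)).exists
  refine ⟨_, h1, ?_⟩
  rw [mul_pow, ← Complex.exp_nat_mul, ← Complex.ofReal_pow, Complex.im_ofReal_mul, ← mul_assoc,
    ← Complex.ofReal_natCast, ← Complex.ofReal_mul, Complex.exp_ofReal_mul_I_im]
  refine mul_pos (by positivity) (Real.sin_pos_of_pos_of_lt_pi ?_ ?_)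
  · have := h2.1; positivity
  · have := h2.2
    rw [lt_div_iff₀ (by positivity)] at this
    linarith

theorem exists_mem_im_pow_neg {N : ℕ} (hN : 0 < N) {t : ℝ} (ht : 0 < t) {U : Set ℂ}
    (hU : U ∈ 𝓝 (t : ℂ)) : ∃ z ∈ U, (z ^ N).im < 0 := by
  have hc : Filter.Tendsto (starRingEnd ℂ) (𝓝 (t : ℂ)) (𝓝 (t : ℂ)) := by
    have := Complex.continuous_conj.tendsto (t : ℂ)
    rwa [Complex.conj_ofReal] at this
  obtain ⟨z, hz, hz'⟩ := exists_mem_im_pow_pos hN ht (hc hU)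
  exact ⟨starRingEnd ℂ z, hz, by rw [← map_pow, Complex.conj_im]; linarith⟩

theorem tendsto_ofReal_nhdsGT :
    Filter.Tendsto (fun t : ℝ => (t : ℂ)) (𝓝[>] 0) (𝓝[≠] 0) := by
  apply tendsto_nhdsWithin_of_tendsto_nhds_of_eventually_within
  · have := Complex.continuous_ofReal.tendsto 0
    rw [Complex.ofReal_zero] at this
    exact this.mono_left nhdsWithin_le_nhds
  · filter_upwards [self_mem_nhdsWithin] with t ht
    simpa using (ne_of_gt ht : t ≠ 0)

/-- A branch of a level curve takes real values for real values of the parameter. -/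
theorem eventually_im_branch_eq_zero {p : MvPolynomial (Fin 2) ℂ} (hp : InducesRIF p)
    (τ₁ τ₂ α : Circle) {N : ℕ} (hN : 0 < N) {g : ℂ → ℂ} (hg : AnalyticAt ℂ g 0)
    (hF : ∀ᶠ t in 𝓝 (0 : ℂ), evalAt (levelPoly τ₁ τ₂ α p) (-g t, t ^ N) = 0) :
    ∀ᶠ t : ℝ in 𝓝[>] 0, (g t).im = 0 := by
  have h := (hF.and hg.eventually_analyticAt).eventually_nhds
  filter_upwards [tendsto_ofReal_nhdsGT.eventually (h.filter_mono nhdsWithin_le_nhds),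
    self_mem_nhdsWithin] with t ht ht0
  have hcont : ContinuousAt (fun z => (g z).im) t :=
    Complex.continuous_im.continuousAt.comp ht.self_of_nhds.2.continuousAt
  -- If `Im (g t) < 0`, then `Im (-g) > 0` persists nearby, and some nearby `z` also has `Im (z ^ N)
  -- > 0`. This is a zero with both coordinates in the upper half-plane. The opposite sign gives one
  -- with both in the lower half-plane.
  rcases lt_trichotomy (g t).im 0 with h1 | h1 | h1
  · obtain ⟨z, hz, hz'⟩ := exists_mem_im_pow_pos hN ht0
      ((hcont.eventually (gt_mem_nhds h1)).and ht)
    exact absurd hz.2.1 (evalAt_levelPoly_ne_zero hp τ₁ τ₂ α (by simpa using hz.1) hz')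
  · exact h1
  · obtain ⟨z, hz, hz'⟩ := exists_mem_im_pow_neg hN ht0
      ((hcont.eventually (lt_mem_nhds h1)).and ht)
    exact absurd hz.2.1 (evalAt_levelPoly_ne_zero_of_im_neg hp τ₁ τ₂ α (by simpa using hz.1) hz')

/-- The denominator does not vanish on a punctured neighbourhood of the origin in a level
curve. -/
theorem eventually_evalAt_biCayley_ne_zero {p : MvPolynomial (Fin 2) ℂ} (hp : InducesRIF p)
    (τ₁ τ₂ α : Circle) {u v : ℂ → ℂ} (hu : AnalyticAt ℂ u 0) (hv : AnalyticAt ℂ v 0)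
    (hu0 : u 0 = 0) (hv0 : v 0 = 0)
    (hinj : Set.InjOn (fun t : ℝ => u t) (Set.Ioi 0) ∨ Set.InjOn (fun t : ℝ => v t) (Set.Ioi 0))
    (hF : ∀ᶠ t in 𝓝 (0 : ℂ), evalAt (levelPoly τ₁ τ₂ α p) (u t, v t) = 0) :
    ∀ᶠ t : ℝ in 𝓝[>] 0, evalAt p (biCayley τ₁ τ₂ (u t, v t)) ≠ 0 := by
  have cay : ∀ {f : ℂ → ℂ}, AnalyticAt ℂ f 0 → f 0 = 0 →
      AnalyticAt ℂ (fun t => cayleyMap (f t)) 0 := by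
    intro f hf hf0
    unfold cayleyMap
    refine (analyticAt_const.add (analyticAt_const.mul hf)).fun_div
      (analyticAt_const.sub (analyticAt_const.mul hf)) (by simp [hf0])
  have den : ∀ {f : ℂ → ℂ}, AnalyticAt ℂ f 0 → f 0 = 0 →
      ∀ᶠ t in 𝓝 0, 1 - Complex.I * f t ≠ 0 := by
    intro f hf hf0
    have : ContinuousAt (fun t => 1 - Complex.I * f t) 0 :=
      continuousAt_const.sub (continuousAt_const.mul hf.continuousAt)
    exact this.eventually_ne (by simp [hf0])
  have han : AnalyticAt ℂ (fun t => evalAt p (biCayley τ₁ τ₂ (u t, v t))) 0 :=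
    (analyticAt_evalAt p _).comp ((analyticAt_const.mul (cay hu hu0)).prod
      (analyticAt_const.mul (cay hv hv0)))
  -- If `p` vanished identically along the curve, so would `p̃ = λ p`. The injective coordinate then
  -- yields infinitely many values at common zeros of coprime polynomials.
  rcases han.eventually_eq_zero_or_eventually_ne_zero with h | h
  · exfalso
    have hall := ((h.and hF).and ((den hu hu0).and (den hv hv0)))
    have hall' := (tendsto_ofReal_nhdsGT.eventually (hall.filter_mono nhdsWithin_le_nhds))
    rw [eventually_nhdsWithin_iff, Metric.eventually_nhds_iff] at hall'
    obtain ⟨ε, hε, hall'⟩ := hall'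
    replace hall' : ∀ t ∈ Set.Ioo (0 : ℝ) ε,
        (evalAt p (biCayley τ₁ τ₂ (u t, v t)) = 0 ∧
          evalAt (reflection p) (biCayley τ₁ τ₂ (u t, v t)) = 0) ∧
          1 - Complex.I * u t ≠ 0 ∧ 1 - Complex.I * v t ≠ 0 := by
      intro t ht
      obtain ⟨⟨a1, a2⟩, a3⟩ := hall' (y := t)
        (by rw [Real.dist_eq, sub_zero, abs_of_pos ht.1]; exact ht.2) ht.1
      refine ⟨⟨a1, ?_⟩, a3⟩
      rw [evalAt_levelPoly_eq_zero_iff _ _ _ _ a3.1 a3.2] at a2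
      rw [a2, a1, mul_zero]
    have hinf : (Set.Ioo (0 : ℝ) ε).Infinite := Set.Ioo_infinite hε
    rcases hinj with hi | hi
    · refine Set.infinite_of_injOn_mapsTo (f := fun t : ℝ => (τ₁ : ℂ) * cayleyMap (u t)) ?_ ?_ hinf
        (finite_setOf_common_zero_fst hp.coprime)
      · intro s hs t ht hst
        exact hi hs.1 ht.1 (cayleyMap_inj (hall' s hs).2.1 (hall' t ht).2.1
          (mul_left_cancel₀ (Circle.coe_ne_zero τ₁) hst))
      · exact fun t ht => ⟨_, (hall' t ht).1⟩
    · refine Set.infinite_of_injOn_mapsTo (f := fun t : ℝ => (τ₂ : ℂ) * cayleyMap (v t)) ?_ ?_ hinf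
        (finite_setOf_common_zero_snd hp.coprime)
      · intro s hs t ht hst
        exact hi hs.1 ht.1 (cayleyMap_inj (hall' s hs).2.2 (hall' t ht).2.2
          (mul_left_cancel₀ (Circle.coe_ne_zero τ₂) hst))
      · exact fun t ht => ⟨_, (hall' t ht).1⟩
  · exact tendsto_ofReal_nhdsGT.eventually h

/-! ### Neighbourhoods of curves in the torus -/

/-- The point of the closed bidisc with polar coordinates `(r₁, θ₁)`, `(r₂, θ₂)` relative to the
point `(τ₁, τ₂)` of the torus. -/
def polarPoint (τ₁ τ₂ : Circle) (r₁ θ₁ r₂ θ₂ : ℝ) : ℂ × ℂ :=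
  (τ₁ * (r₁ * Complex.exp (θ₁ * Complex.I)), τ₂ * (r₂ * Complex.exp (θ₂ * Complex.I)))

/-- `φ₁` and `φ₂` deviate at most linearly from the constants `α₁`, `α₂` near the curve
`θ₁ = h θ₂` in the torus. -/
def NearlyConstantAlongCurve (τ₁ τ₂ α₁ α₂ : Circle) (φ₁ φ₂ : ℂ × ℂ → ℂ) : Prop :=
  ∃ (L δ₀ a b : ℝ) (h : ℝ → ℝ), 0 < L ∧ 0 < δ₀ ∧ δ₀ ≤ 1 / 2 ∧ -Real.pi ≤ a ∧ a < b ∧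
    b ≤ Real.pi ∧ (∀ s ∈ Set.Ioo a b, |h s| ≤ Real.pi / 2) ∧
    ∀ δ ∈ Set.Ioo 0 δ₀, ∀ s ∈ Set.Ioo a b, ∀ θ ∈ Set.Ioo (h s - δ) (h s + δ),
      ∀ r₁ ∈ Set.Ioo (1 - δ) 1, ∀ r₂ ∈ Set.Ioo (1 - δ) 1,
        ‖φ₁ (polarPoint τ₁ τ₂ r₁ θ r₂ s) - α₁‖ ≤ L * δ ∧
        ‖φ₂ (polarPoint τ₁ τ₂ r₁ θ r₂ s) - α₂‖ ≤ L * δ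

theorem norm_exp_mul_I_sub_exp_mul_I_le (x y : ℝ) :
    ‖Complex.exp (x * Complex.I) - Complex.exp (y * Complex.I)‖ ≤ |x - y| := by
  have h : Complex.exp (x * Complex.I) - Complex.exp (y * Complex.I) =
      Complex.exp (y * Complex.I) * (Complex.exp (Complex.I * (x - y : ℝ)) - 1) := by
    rw [mul_sub, ← Complex.exp_add, mul_one]
    congr 2
    push_cast; ring
  rw [h, norm_mul, Complex.norm_exp_ofReal_mul_I, one_mul]
  simpa using Real.norm_exp_I_mul_ofReal_sub_one_le (x := x - y)

theorem norm_mul_exp_sub_le (τ : Circle) {r θ ψ δ : ℝ} (hr : r ∈ Set.Ioo (1 - δ) 1)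
    (hθ : |θ - ψ| ≤ δ) :
    ‖(τ : ℂ) * (r * Complex.exp (θ * Complex.I)) - τ * Complex.exp (ψ * Complex.I)‖ ≤ 2 * δ := by
  rw [← mul_sub, norm_mul, Circle.norm_coe, one_mul]
  have e : (r : ℂ) * Complex.exp (θ * Complex.I) - Complex.exp (ψ * Complex.I) =
      ((r - 1 : ℝ) : ℂ) * Complex.exp (θ * Complex.I) +
        (Complex.exp (θ * Complex.I) - Complex.exp (ψ * Complex.I)) := by push_cast; ring
  rw [e]
  refine (norm_add_le _ _).trans ?_
  rw [norm_mul, Complex.norm_exp_ofReal_mul_I, mul_one, Complex.norm_real, Real.norm_eq_abs]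
  have h1 := norm_exp_mul_I_sub_exp_mul_I_le θ ψ
  have h2 : |r - 1| ≤ δ := by rw [abs_le]; constructor <;> linarith [hr.1, hr.2]
  linarith

theorem biCayley_ofReal (τ₁ τ₂ : Circle) (x y : ℝ) :
    biCayley τ₁ τ₂ (x, y) = (τ₁ * Complex.exp ((2 * Real.arctan x : ℝ) * Complex.I),
      τ₂ * Complex.exp ((2 * Real.arctan y : ℝ) * Complex.I)) := by
  rw [biCayley, cayleyMap_ofReal, cayleyMap_ofReal]

/-- A point at distance at most `2 δ` from the curve is compared with the curve point of the same
angle `s` by the Lipschitz bound. The angles on the curve are `2 arctan (x t)` and `2 arctan (t ^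
N)`. -/
theorem nearlyConstantAlongCurve_of_lipschitz {τ₁ τ₂ α₁ α₂ : Circle} {φ₁ φ₂ : ℂ × ℂ → ℂ}
    {x : ℝ → ℝ} {t₀ : ℝ} {N : ℕ} (hN : 0 < N) (ht₀ : 0 < t₀) (hx : ContinuousAt x t₀)
    (hx1 : |x t₀| < 1)
    (hL₁ : ∃ K, ∃ U ∈ 𝓝 (biCayley τ₁ τ₂ (x t₀, (t₀ ^ N : ℝ))), LipschitzOnWith K φ₁ U)
    (hL₂ : ∃ K, ∃ U ∈ 𝓝 (biCayley τ₁ τ₂ (x t₀, (t₀ ^ N : ℝ))), LipschitzOnWith K φ₂ U)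
    (h₁ : ∀ᶠ t in 𝓝 t₀, φ₁ (biCayley τ₁ τ₂ (x t, (t ^ N : ℝ))) = α₁)
    (h₂ : ∀ᶠ t in 𝓝 t₀, φ₂ (biCayley τ₁ τ₂ (x t, (t ^ N : ℝ))) = α₂) :
    NearlyConstantAlongCurve τ₁ τ₂ α₁ α₂ φ₁ φ₂ := by
  obtain ⟨K₁, U₁, hU₁, hK₁⟩ := hL₁
  obtain ⟨K₂, U₂, hU₂, hK₂⟩ := hL₂
  obtain ⟨ε, hε, hball⟩ := Metric.mem_nhds_iff.1 (Filter.inter_mem hU₁ hU₂)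
  have hcont : ContinuousAt (fun t => biCayley τ₁ τ₂ (x t, (t ^ N : ℝ))) t₀ := by
    simp only [biCayley_ofReal]
    fun_prop
  have hev := (((hcont.eventually (Metric.ball_mem_nhds _ (half_pos hε))).and
    (hx.abs.eventually (gt_mem_nhds hx1))).and (h₁.and h₂)).and (lt_mem_nhds ht₀)
  obtain ⟨η, hη, hη'⟩ := Metric.eventually_nhds_iff.1 hev
  have hIoo : ∀ t ∈ Set.Icc (t₀ - η / 2) (t₀ + η / 2), dist t t₀ < η := by
    intro t ht
    rw [Real.dist_eq, abs_lt]
    constructor <;> linarith [ht.1, ht.2]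
  have hpos : 0 < t₀ - η / 2 := (hη' (hIoo _ ⟨le_rfl, by linarith⟩)).2
  -- The arc is reparametrised by the second angle. Any choice of preimage will do: no regularity of
  -- `T` is used.
  have hivt : ∀ s ∈ Set.Ioo (2 * Real.arctan ((t₀ - η / 2) ^ N))
      (2 * Real.arctan ((t₀ + η / 2) ^ N)),
      ∃ t ∈ Set.Ioo (t₀ - η / 2) (t₀ + η / 2), 2 * Real.arctan (t ^ N) = s := by
    intro s hs
    have hc : ContinuousOn (fun t : ℝ => 2 * Real.arctan (t ^ N))
        (Set.Icc (t₀ - η / 2) (t₀ + η / 2)) := by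
      apply Continuous.continuousOn
      fun_prop
    exact intermediate_value_Ioo (by linarith) hc hs
  choose! T hT hT' using hivt
  -- The slope covers `2 K₁ δ` and `2 K₂ δ`, with `+ 1` for positivity. With `δ < ε / 8` the polar
  -- point lies within `ε / 2 + ε / 4 < ε` of the centre, inside both Lipschitz neighbourhoods.
  refine ⟨2 * (K₁ + K₂) + 1, min (1 / 2) (ε / 8), 2 * Real.arctan ((t₀ - η / 2) ^ N),
    2 * Real.arctan ((t₀ + η / 2) ^ N), fun s => 2 * Real.arctan (x (T s)),
    by positivity, by positivity, min_le_left _ _, ?_, ?_, ?_, fun s hs => ?_,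
    fun δ hδ s hs θ hθ r₁ hr₁ r₂ hr₂ => ?_⟩
  · linarith [Real.neg_pi_div_two_lt_arctan ((t₀ - η / 2) ^ N)]
  · have := Real.arctan_strictMono
      (pow_lt_pow_left₀ (show t₀ - η / 2 < t₀ + η / 2 by linarith) hpos.le hN.ne')
    linarith
  · linarith [Real.arctan_lt_pi_div_two ((t₀ + η / 2) ^ N)]
  · have h := abs_lt.1 (hη' (hIoo _ ⟨(hT s hs).1.le, (hT s hs).2.le⟩)).1.1.2
    have h1 := Real.arctan_strictMono h.1
    have h2 := Real.arctan_strictMono h.2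
    rw [Real.arctan_neg, Real.arctan_one] at h1
    rw [Real.arctan_one] at h2
    rw [abs_le]
    constructor <;> linarith
  · have hδ1 : δ < 1 / 2 := hδ.2.trans_le (min_le_left _ _)
    have hδε : δ < ε / 8 := hδ.2.trans_le (min_le_right _ _)
    obtain ⟨⟨⟨hb, -⟩, e₁, e₂⟩, -⟩ := hη' (hIoo _ ⟨(hT s hs).1.le, (hT s hs).2.le⟩)
    set w := biCayley τ₁ τ₂ (x (T s), (T s ^ N : ℝ)) with hw
    have hdist : dist (polarPoint τ₁ τ₂ r₁ θ r₂ s) w ≤ 2 * δ := by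
      rw [hw, biCayley_ofReal, hT' s hs, Prod.dist_eq, max_le_iff, dist_eq_norm, dist_eq_norm]
      refine ⟨norm_mul_exp_sub_le τ₁ hr₁ ?_,
        norm_mul_exp_sub_le τ₂ hr₂ (by simpa using hδ.1.le)⟩
      rw [abs_le]
      constructor <;> linarith [hθ.1, hθ.2]
    beta_reduce at hb
    have hwm : w ∈ U₁ ∩ U₂ := hball (by rw [Metric.mem_ball]; linarith)
    have hpm : polarPoint τ₁ τ₂ r₁ θ r₂ s ∈ U₁ ∩ U₂ := hball (by
      rw [Metric.mem_ball]
      have := dist_triangle (polarPoint τ₁ τ₂ r₁ θ r₂ s) w (biCayley τ₁ τ₂ (x t₀, (t₀ ^ N : ℝ)))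
      linarith)
    have k₁ := hK₁.dist_le_mul _ hpm.1 _ hwm.1
    have k₂ := hK₂.dist_le_mul _ hpm.2 _ hwm.2
    rw [e₁, dist_eq_norm] at k₁
    rw [e₂, dist_eq_norm] at k₂
    have m₁ := mul_le_mul_of_nonneg_left hdist K₁.coe_nonneg
    have m₂ := mul_le_mul_of_nonneg_left hdist K₂.coe_nonneg
    have n₁ := mul_nonneg K₁.coe_nonneg hδ.1.le
    have n₂ := mul_nonneg K₂.coe_nonneg hδ.1.le
    have := hδ.1
    constructor <;> nlinarith

theorem exists_lipschitzOnWith_rif {p : MvPolynomial (Fin 2) ℂ} {z : ℂ × ℂ}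
    (hz : evalAt p z ≠ 0) : ∃ K, ∃ U ∈ 𝓝 z, LipschitzOnWith K (rif p) U := by
  have h : AnalyticAt ℂ (rif p) z := (analyticAt_evalAt (reflection p) z).fun_div
    (analyticAt_evalAt p z) hz
  exact h.contDiffAt.exists_lipschitzOnWith

theorem rif_biCayley_eq {p : MvPolynomial (Fin 2) ℂ} {τ₁ τ₂ α : Circle} {x y : ℝ}
    (h : evalAt (levelPoly τ₁ τ₂ α p) (x, y) = 0)
    (h0 : evalAt p (biCayley τ₁ τ₂ (x, y)) ≠ 0) :
    rif p (biCayley τ₁ τ₂ (x, y)) = levelValue τ₁ τ₂ α p := by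
  rw [evalAt_levelPoly_eq_zero_iff _ _ _ _ (one_sub_I_mul_ne_zero_of_im_nonneg (by simp))
    (one_sub_I_mul_ne_zero_of_im_nonneg (by simp))] at h
  rw [rif, h, mul_div_cancel_right₀ _ h0]

theorem nearlyConstantAlongCurve_of_branch {p₁ p₂ : MvPolynomial (Fin 2) ℂ}
    (hp₁ : InducesRIF p₁) (hp₂ : InducesRIF p₂) (τ₁ τ₂ α₁ α₂ : Circle) {N : ℕ} (hN : 0 < N)
    {g : ℂ → ℂ} (hg : AnalyticAt ℂ g 0) (hg0 : g 0 = 0)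
    (h₁ : ∀ᶠ t in 𝓝 (0 : ℂ), evalAt (levelPoly τ₁ τ₂ α₁ p₁) (-g t, t ^ N) = 0)
    (h₂ : ∀ᶠ t in 𝓝 (0 : ℂ), evalAt (levelPoly τ₁ τ₂ α₂ p₂) (-g t, t ^ N) = 0) :
    NearlyConstantAlongCurve τ₁ τ₂ (levelValue τ₁ τ₂ α₁ p₁) (levelValue τ₁ τ₂ α₂ p₂)
      (rif p₁) (rif p₂) := by
  have hinj : Set.InjOn (fun t : ℝ => (t : ℂ) ^ N) (Set.Ioi 0) := by
    intro s hs t ht hst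
    have : s ^ N = t ^ N := by
      simp only at hst
      exact_mod_cast hst
    exact (pow_left_inj₀ (le_of_lt hs) (le_of_lt ht) hN.ne').1 this
  have hne : ∀ (p : MvPolynomial (Fin 2) ℂ) (α : Circle), InducesRIF p →
      (∀ᶠ t in 𝓝 (0 : ℂ), evalAt (levelPoly τ₁ τ₂ α p) (-g t, t ^ N) = 0) →
      ∀ᶠ t : ℝ in 𝓝[>] 0, evalAt p (biCayley τ₁ τ₂ (-g t, (t : ℂ) ^ N)) ≠ 0 := fun p α hp h =>
    eventually_evalAt_biCayley_ne_zero hp τ₁ τ₂ α (u := fun t => -g t) (v := fun t => t ^ N)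
      hg.neg (by fun_prop) (by simp [hg0]) (by simp [hN.ne']) (Or.inr hinj) h
  have hsmall : ∀ᶠ t in 𝓝 (0 : ℂ), ‖g t‖ < 1 := by
    have := hg.continuousAt.norm
    exact this.eventually (gt_mem_nhds (by simp [hg0]))
  have hgood := ((hsmall.and hg.eventually_analyticAt).and (h₁.and h₂)).filter_mono
    (nhdsWithin_le_nhds (s := {0}ᶜ))
  have hall := ((tendsto_ofReal_nhdsGT.eventually hgood).and
    (eventually_im_branch_eq_zero hp₁ τ₁ τ₂ α₁ hN hg h₁)).and ((hne p₁ α₁ hp₁ h₁).and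
      (hne p₂ α₂ hp₂ h₂))
  rw [eventually_nhdsWithin_iff, Metric.eventually_nhds_iff] at hall
  obtain ⟨ε, hε, hall⟩ := hall
  replace hall : ∀ t ∈ Set.Ioo 0 ε, _ := fun t ht => hall (y := t)
    (by rw [Real.dist_eq, sub_zero, abs_of_pos ht.1]; exact ht.2) ht.1
  have hgre : ∀ t ∈ Set.Ioo 0 ε, ((-(g t).re : ℝ) : ℂ) = -g t := fun t ht => by
    apply Complex.ext
    · simp
    · simp [(hall t ht).1.2]
  -- The base point is moved off the origin, where `p₁` and `p₂` may vanish.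
  have ht₀ : ε / 2 ∈ Set.Ioo 0 ε := ⟨by linarith, by linarith⟩
  have hmem : Set.Ioo 0 ε ∈ 𝓝 (ε / 2) := Ioo_mem_nhds ht₀.1 ht₀.2
  have hc : ∀ t ∈ Set.Ioo 0 ε, evalAt p₁ (biCayley τ₁ τ₂ ((-(g t).re : ℝ), (t ^ N : ℝ))) ≠ 0 ∧
      evalAt p₂ (biCayley τ₁ τ₂ ((-(g t).re : ℝ), (t ^ N : ℝ))) ≠ 0 := fun t ht => by
    rw [hgre t ht, Complex.ofReal_pow]
    exact (hall t ht).2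
  refine nearlyConstantAlongCurve_of_lipschitz (x := fun t => -(g t).re) hN ht₀.1 ?_ ?_
    (exists_lipschitzOnWith_rif (hc _ ht₀).1) (exists_lipschitzOnWith_rif (hc _ ht₀).2) ?_ ?_
  · have hgc : ContinuousAt g ((ε / 2 : ℝ) : ℂ) := (hall _ ht₀).1.1.1.2.continuousAt
    have : ContinuousAt (fun t : ℝ => g t) (ε / 2) :=
      ContinuousAt.comp (f := fun t : ℝ => (t : ℂ)) hgc Complex.continuous_ofReal.continuousAt
    exact (Complex.continuous_re.continuousAt.comp this).neg
  · rw [abs_neg]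
    exact (Complex.abs_re_le_norm _).trans_lt (hall _ ht₀).1.1.1.1
  · filter_upwards [hmem] with t ht
    refine rif_biCayley_eq ?_ (hc t ht).1
    rw [hgre t ht, Complex.ofReal_pow]
    exact (hall t ht).1.1.2.1
  · filter_upwards [hmem] with t ht
    refine rif_biCayley_eq ?_ (hc t ht).2
    rw [hgre t ht, Complex.ofReal_pow]
    exact (hall t ht).1.1.2.2

theorem biCayley_swap (τ₁ τ₂ : Circle) (x y : ℂ) :
    (biCayley τ₂ τ₁ (x, y)).swap = biCayley τ₁ τ₂ (y, x) := rfl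

/-- The line `w₂ = 0` is not a graph over `w₂`. With the coordinates exchanged it becomes the graph
of the zero function, with `N = 1`. -/
theorem nearlyConstantAlongCurve_of_line {p₁ p₂ : MvPolynomial (Fin 2) ℂ}
    (hp₁ : InducesRIF p₁) (hp₂ : InducesRIF p₂) (τ₁ τ₂ α₁ α₂ : Circle)
    (h₁ : ∀ᶠ t in 𝓝 (0 : ℂ), evalAt (levelPoly τ₁ τ₂ α₁ p₁) (t, 0) = 0)
    (h₂ : ∀ᶠ t in 𝓝 (0 : ℂ), evalAt (levelPoly τ₁ τ₂ α₂ p₂) (t, 0) = 0) :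
    NearlyConstantAlongCurve τ₂ τ₁ (levelValue τ₁ τ₂ α₁ p₁) (levelValue τ₁ τ₂ α₂ p₂)
      (fun z => rif p₁ z.swap) (fun z => rif p₂ z.swap) := by
  have hinj : Set.InjOn (fun t : ℝ => (t : ℂ)) (Set.Ioi 0) := Complex.ofReal_injective.injOn
  have hne : ∀ (p : MvPolynomial (Fin 2) ℂ) (α : Circle), InducesRIF p →
      (∀ᶠ t in 𝓝 (0 : ℂ), evalAt (levelPoly τ₁ τ₂ α p) (t, 0) = 0) →
      ∀ᶠ t : ℝ in 𝓝[>] 0, evalAt p (biCayley τ₁ τ₂ (t, 0)) ≠ 0 := fun p α hp h =>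
    eventually_evalAt_biCayley_ne_zero hp τ₁ τ₂ α (u := fun t => t) (v := fun _ => 0)
      analyticAt_id analyticAt_const rfl rfl (Or.inl hinj) h
  have hgood := (h₁.and h₂).filter_mono (nhdsWithin_le_nhds (s := {0}ᶜ))
  have hall := (tendsto_ofReal_nhdsGT.eventually hgood).and ((hne p₁ α₁ hp₁ h₁).and
      (hne p₂ α₂ hp₂ h₂))
  rw [eventually_nhdsWithin_iff, Metric.eventually_nhds_iff] at hall
  obtain ⟨ε, hε, hall⟩ := hall
  replace hall : ∀ t ∈ Set.Ioo 0 ε, _ := fun t ht => hall (y := t)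
    (by rw [Real.dist_eq, sub_zero, abs_of_pos ht.1]; exact ht.2) ht.1
  have ht₀ : ε / 2 ∈ Set.Ioo 0 ε := ⟨by linarith, by linarith⟩
  have hmem : Set.Ioo 0 ε ∈ 𝓝 (ε / 2) := Ioo_mem_nhds ht₀.1 ht₀.2
  have hlip : ∀ p : MvPolynomial (Fin 2) ℂ, ∀ z : ℂ × ℂ, evalAt p z.swap ≠ 0 →
      ∃ K, ∃ U ∈ 𝓝 z, LipschitzOnWith K (fun z => rif p z.swap) U := by
    intro p z hz
    obtain ⟨K, U, hU, hK⟩ := exists_lipschitzOnWith_rif hz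
    refine ⟨K, Prod.swap ⁻¹' U, continuous_swap.continuousAt hU, fun v hv w hw => ?_⟩
    refine (hK hv hw).trans_eq ?_
    rw [Prod.edist_eq, Prod.edist_eq, max_comm]; rfl
  refine nearlyConstantAlongCurve_of_lipschitz (x := fun _ => 0) one_pos ht₀.1
    continuousAt_const (by simp) (hlip _ _ ?_) (hlip _ _ ?_) ?_ ?_
  · simpa [biCayley_swap] using (hall _ ht₀).2.1
  · simpa [biCayley_swap] using (hall _ ht₀).2.2
  · filter_upwards [hmem] with t ht
    rw [biCayley_swap, pow_one]
    exact rif_biCayley_eq (by simpa using (hall t ht).1.1) (by simpa using (hall t ht).2.1)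
  · filter_upwards [hmem] with t ht
    rw [biCayley_swap, pow_one]
    exact rif_biCayley_eq (by simpa using (hall t ht).1.2) (by simpa using (hall t ht).2.2)

open MeasureTheory

/-! ### Measures on circles and on the disc -/

/-- Arc length on the unit circle, transported to the circle of radius `r`. -/
def circleMeasure (r : ℝ) : Measure ℂ :=
  (volume.restrict (Set.Ioc (-Real.pi) Real.pi)).map fun θ : ℝ =>
    (r : ℂ) * Complex.exp (θ * Complex.I)

theorem measurable_mul_exp (r : ℝ) :
    Measurable fun θ : ℝ => (r : ℂ) * Complex.exp (θ * Complex.I) :=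
  Continuous.measurable (by fun_prop)

instance (r : ℝ) : IsFiniteMeasure (circleMeasure r) := by
  unfold circleMeasure; infer_instance

/-- Both intervals are fundamental domains for translation by `2π`, under which the integrand is
invariant. -/
theorem setLIntegral_Ioc_two_pi_eq (a b : ℝ) (H : ℂ → ℝ≥0∞) (r : ℝ) :
    ∫⁻ θ in Set.Ioc a (a + 2 * Real.pi), H (r * Complex.exp ((θ : ℝ) * Complex.I)) =
      ∫⁻ θ in Set.Ioc b (b + 2 * Real.pi), H (r * Complex.exp ((θ : ℝ) * Complex.I)) := by
  have : VAddInvariantMeasure (AddSubgroup.zmultiples (2 * Real.pi)) ℝ volume :=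
    ⟨fun c s _ => measure_preimage_add _ _ _⟩
  refine (isAddFundamentalDomain_Ioc Real.two_pi_pos a).setLIntegral_eq
    (isAddFundamentalDomain_Ioc Real.two_pi_pos b) _ ?_
  rintro ⟨_, n, rfl⟩ θ
  congr 2
  simp only [AddSubgroup.vadd_def, vadd_eq_add, zsmul_eq_mul]
  have := Complex.exp_mul_I_periodic.int_mul n (θ : ℂ)
  rw [← this]
  congr 2
  push_cast
  ring

theorem map_restrict_Ioc_two_pi (r : ℝ) :
    (volume.restrict (Set.Ioc (0 : ℝ) (2 * Real.pi))).map
      (fun θ : ℝ => (r : ℂ) * Complex.exp (θ * Complex.I)) = circleMeasure r := by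
  refine Measure.ext_of_lintegral _ fun g hg => ?_
  rw [circleMeasure, lintegral_map hg (measurable_mul_exp r),
    lintegral_map hg (measurable_mul_exp r)]
  have := setLIntegral_Ioc_two_pi_eq 0 (-Real.pi) g r
  rwa [zero_add, show -Real.pi + 2 * Real.pi = Real.pi by ring] at this

/-- Rotation invariance: angles may be measured from any point `τ` of the circle. -/
theorem lintegral_circleMeasure (τ : Circle) (r : ℝ) {g : ℂ → ℝ≥0∞} (hg : Measurable g) :
    ∫⁻ z, g z ∂circleMeasure r = ∫⁻ θ in Set.Ioc (-Real.pi) Real.pi,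
      g (τ * (r * Complex.exp ((θ : ℝ) * Complex.I))) := by
  set c := Complex.arg τ with hc
  have hτ : (τ : ℂ) = Complex.exp (c * Complex.I) := by
    have := Complex.norm_mul_exp_arg_mul_I (τ : ℂ)
    rw [Circle.norm_coe, Complex.ofReal_one, one_mul] at this
    exact this.symm
  have h1 : ∀ θ : ℝ, (τ : ℂ) * (r * Complex.exp (θ * Complex.I)) =
      r * Complex.exp ((θ + c : ℝ) * Complex.I) := by
    intro θ
    rw [hτ, mul_left_comm, ← Complex.exp_add]
    congr 2
    push_cast; ring
  simp only [h1]
  have h2 := (measurePreserving_add_right volume c).setLIntegral_comp_preimage_emb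
    (measurableEmbedding_addRight c)
    (fun θ : ℝ => g (r * Complex.exp (θ * Complex.I))) (Set.Ioc (-Real.pi + c) (Real.pi + c))
  rw [Set.preimage_add_const_Ioc, add_sub_cancel_right, add_sub_cancel_right] at h2
  rw [h2, circleMeasure, lintegral_map hg (measurable_mul_exp r)]
  have h3 := setLIntegral_Ioc_two_pi_eq (-Real.pi) (-Real.pi + c) g r
  rwa [show -Real.pi + 2 * Real.pi = Real.pi by ring,
    show -Real.pi + c + 2 * Real.pi = Real.pi + c by ring] at h3

/-- The weight of the Bergman space. -/
def bergmanWeight (β : ℝ) (z : ℂ) : ℝ≥0∞ := ENNReal.ofReal ((1 - ‖z‖ ^ 2) ^ β)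

theorem measurable_bergmanWeight (β : ℝ) : Measurable (bergmanWeight β) := by
  unfold bergmanWeight
  fun_prop

/-- The weighted area measure `(1 - |z|²)^β` on the disc. -/
def bergmanMeasure (β : ℝ) : Measure ℂ :=
  (volume.restrict (Metric.ball (0 : ℂ) 1)).withDensity (bergmanWeight β)

instance (β : ℝ) : SFinite (bergmanMeasure β) := by
  unfold bergmanMeasure; infer_instance

/-- With the norm written against a product measure, the Bergman and Hardy cases share the same
Tonelli arguments. -/
theorem normSq_eq_bergman {β : ℝ} (hβ : β ≠ -1) {F : ℂ × ℂ → ℂ} (hF : Measurable F) :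
    normSq β F = ENNReal.ofReal (1 / Real.pi ^ 2) *
      ∫⁻ z, ‖F z‖ₑ ^ 2 ∂(bergmanMeasure β).prod (bergmanMeasure β) := by
  rw [normSq, if_neg hβ]
  congr 1
  have hw := measurable_bergmanWeight β
  rw [bergmanMeasure, prod_withDensity hw hw, Measure.prod_restrict, ← bidisc_eq,
    lintegral_withDensity_eq_lintegral_mul _ (by fun_prop) (by fun_prop)]
  refine setLIntegral_congr_fun isOpen_bidisc.measurableSet fun z hz => ?_
  have : 0 ≤ (1 - ‖z.1‖ ^ 2) ^ β := by
    apply Real.rpow_nonneg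
    have := hz.1
    nlinarith [norm_nonneg z.1]
  simp only [bergmanWeight, Pi.mul_apply]
  rw [ENNReal.ofReal_mul this, mul_comm]

theorem normSq_eq_hardy {F : ℂ × ℂ → ℂ} (hF : Measurable F) :
    normSq (-1) F = ⨆ r ∈ Set.Ioo (0 : ℝ) 1, ENNReal.ofReal (1 / (2 * Real.pi) ^ 2) *
      ∫⁻ z, ‖F z‖ₑ ^ 2 ∂(circleMeasure r).prod (circleMeasure r) := by
  rw [normSq, if_pos rfl]
  refine iSup_congr fun r => iSup_congr fun _ => ?_
  congr 1
  rw [← map_restrict_Ioc_two_pi, Measure.map_prod_map _ _ (measurable_mul_exp r)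
    (measurable_mul_exp r), lintegral_map (by fun_prop)
    ((measurable_mul_exp r).prodMap (measurable_mul_exp r)), Measure.prod_restrict]
  rfl

theorem lintegral_bergmanMeasure (β : ℝ) {g : ℂ → ℝ≥0∞} (hg : Measurable g) :
    ∫⁻ z, g z ∂bergmanMeasure β = ∫⁻ r in Set.Ioo (0 : ℝ) 1,
      ENNReal.ofReal (r * (1 - r ^ 2) ^ β) * ∫⁻ z, g z ∂circleMeasure r := by
  have hw := measurable_bergmanWeight β
  rw [bergmanMeasure, lintegral_withDensity_eq_lintegral_mul _ hw hg,
    ← lintegral_indicator Metric.isOpen_ball.measurableSet, ← Complex.lintegral_comp_polarCoord_symm,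
    polarCoord_target]
  have hmeas : Measurable fun p : ℝ × ℝ => ENNReal.ofReal p.1 •
      (Metric.ball (0 : ℂ) 1).indicator (bergmanWeight β * g) (Complex.polarCoord.symm p) := by
    have h1 : Measurable ((Metric.ball (0 : ℂ) 1).indicator (bergmanWeight β * g)) :=
      (hw.mul hg).indicator Metric.isOpen_ball.measurableSet
    have h2 : Measurable fun p : ℝ × ℝ => Complex.polarCoord.symm p := by
      simp only [Complex.polarCoord_symm_apply]
      exact Continuous.measurable (by fun_prop)
    exact (by fun_prop : Measurable fun p : ℝ × ℝ => ENNReal.ofReal p.1).smul (h1.comp h2)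
  rw [Measure.volume_eq_prod, ← Measure.prod_restrict, lintegral_prod _ hmeas.aemeasurable,
    ← lintegral_indicator measurableSet_Ioi, ← lintegral_indicator measurableSet_Ioo]
  refine lintegral_congr fun r => ?_
  by_cases hr0 : 0 < r
  swap
  · rw [Set.indicator_of_notMem (by simpa using hr0),
      Set.indicator_of_notMem (fun h => hr0 h.1)]
  rw [Set.indicator_of_mem (by exact hr0)]
  have hsymm : ∀ θ : ℝ, Complex.polarCoord.symm (r, θ) = r * Complex.exp (θ * Complex.I) := by
    intro θ
    rw [Complex.polarCoord_symm_apply, Complex.exp_mul_I]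
    simp
  have hnorm : ∀ θ : ℝ, ‖(r : ℂ) * Complex.exp (θ * Complex.I)‖ = r := by
    intro θ
    rw [norm_mul, Complex.norm_exp_ofReal_mul_I, mul_one, Complex.norm_real,
      Real.norm_of_nonneg hr0.le]
  simp only [hsymm]
  by_cases hr1 : r < 1
  swap
  · rw [Set.indicator_of_notMem (fun h => hr1 h.2)]
    refine (lintegral_congr fun θ => ?_).trans lintegral_zero
    rw [Set.indicator_of_notMem, smul_zero]
    rw [mem_ball_zero_iff, hnorm]
    exact hr1
  rw [Set.indicator_of_mem (show r ∈ Set.Ioo (0 : ℝ) 1 from ⟨hr0, hr1⟩), circleMeasure,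
    lintegral_map hg (measurable_mul_exp r), setLIntegral_congr Ioo_ae_eq_Ioc,
    ← lintegral_const_mul _ (by exact hg.comp (measurable_mul_exp r))]
  refine lintegral_congr fun θ => ?_
  rw [Set.indicator_of_mem (by rw [mem_ball_zero_iff, hnorm]; exact hr1), Pi.mul_apply,
    bergmanWeight, hnorm, smul_eq_mul, ENNReal.ofReal_mul hr0.le, mul_assoc]

/-- The sector of points `τ r e^{iθ}` with `1 - δ < r < 1 - δ / 2` and `a < θ < b`. -/
def sector (τ : Circle) (δ a b : ℝ) : Set ℂ :=
  {z | ‖z‖ ∈ Set.Ioo (1 - δ) (1 - δ / 2) ∧ Complex.arg (z * (τ⁻¹ : Circle)) ∈ Set.Ioo a b}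

theorem measurableSet_sector (τ : Circle) (δ a b : ℝ) : MeasurableSet (sector τ δ a b) := by
  refine MeasurableSet.inter (measurable_norm measurableSet_Ioo) ?_
  have : Measurable fun z : ℂ => Complex.arg (z * (τ⁻¹ : Circle)) :=
    Complex.measurable_arg.comp (by fun_prop)
  exact this measurableSet_Ioo

theorem exists_polar_of_mem_sector {τ : Circle} {δ a b : ℝ} {z : ℂ} (hz : z ∈ sector τ δ a b) :
    ∃ r ∈ Set.Ioo (1 - δ) (1 - δ / 2), ∃ θ ∈ Set.Ioo a b,
      z = τ * (r * Complex.exp (θ * Complex.I)) := by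
  refine ⟨_, hz.1, _, hz.2, ?_⟩
  have h := Complex.norm_mul_exp_arg_mul_I (z * (τ⁻¹ : Circle))
  rw [norm_mul, Circle.norm_coe, mul_one] at h
  rw [h, mul_left_comm, ← Circle.coe_mul, mul_inv_cancel, Circle.coe_one, mul_one]

theorem le_circleMeasure_sector (τ : Circle) {δ a b r : ℝ} (hr0 : 0 < r)
    (hr : r ∈ Set.Ioo (1 - δ) (1 - δ / 2)) (ha : -Real.pi ≤ a) (hb : b ≤ Real.pi) :
    ENNReal.ofReal (b - a) ≤ circleMeasure r (sector τ δ a b) := by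
  have hm := measurableSet_sector τ δ a b
  rw [← lintegral_indicator_one hm, lintegral_circleMeasure τ r (measurable_one.indicator hm),
    ← Real.volume_Ioo, ← lintegral_indicator_one measurableSet_Ioo,
    ← lintegral_indicator measurableSet_Ioc]
  refine lintegral_mono fun θ => ?_
  by_cases hθ : θ ∈ Set.Ioo a b
  · have hθ' : θ ∈ Set.Ioc (-Real.pi) Real.pi := ⟨ha.trans_lt hθ.1, hθ.2.le.trans hb⟩
    have hmem : (τ : ℂ) * (r * Complex.exp (θ * Complex.I)) ∈ sector τ δ a b := by
      refine ⟨?_, ?_⟩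
      · rwa [norm_mul, norm_mul, Circle.norm_coe, one_mul, Complex.norm_exp_ofReal_mul_I, mul_one,
          Complex.norm_real, Real.norm_of_nonneg hr0.le]
      · rw [mul_right_comm, ← Circle.coe_mul, mul_inv_cancel, Circle.coe_one, one_mul,
          Complex.arg_real_mul _ hr0, Complex.arg_exp_mul_I, toIocMod_eq_self _ |>.2]
        · exact hθ
        · rwa [show -Real.pi + 2 * Real.pi = Real.pi by ring]
    rw [Set.indicator_of_mem hθ, Set.indicator_of_mem hθ', Set.indicator_of_mem hmem]
    rfl
  · rw [Set.indicator_of_notMem hθ]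
    exact zero_le

/-! ### Lower bounds for norms -/

theorem two_rpow_neg_abs_le {x β : ℝ} (h1 : 1 / 2 ≤ x) (h2 : x ≤ 2) :
    (2 : ℝ) ^ (-|β|) ≤ x ^ β := by
  have hx : 0 < x := by linarith
  rw [Real.rpow_def_of_pos two_pos, Real.rpow_def_of_pos hx, Real.exp_le_exp]
  have hlog2 : Real.log x ≤ Real.log 2 := Real.log_le_log hx h2
  have hlog1 : -Real.log 2 ≤ Real.log x := by
    rw [← Real.log_inv]
    exact Real.log_le_log (by norm_num) (by linarith)
  have habs : |Real.log x * β| ≤ Real.log 2 * |β| := by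
    rw [abs_mul]
    exact mul_le_mul_of_nonneg_right (abs_le.2 ⟨hlog1, hlog2⟩) (abs_nonneg _)
  linarith [neg_abs_le (Real.log x * β)]

theorem rpow_le_two_rpow_abs {x β : ℝ} (h1 : 1 / 2 ≤ x) (h2 : x ≤ 2) :
    x ^ β ≤ (2 : ℝ) ^ |β| := by
  have h := two_rpow_neg_abs_le (β := -β) h1 h2
  rw [abs_neg, Real.rpow_neg two_pos.le, Real.rpow_neg (show 0 ≤ x by linarith)] at h
  exact (inv_le_inv₀ (by positivity) (Real.rpow_pos_of_pos (by linarith) _)).1 h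

/-- On the sector `1 - r` is comparable to `δ`, so the weight is comparable to `δ^β` whatever the
sign of `β`; the radial width `δ / 2` supplies the remaining power of `δ`. -/
theorem le_bergmanMeasure_sector (β : ℝ) (τ : Circle) {δ a b : ℝ} (hδ0 : 0 < δ)
    (hδ : δ ≤ 1 / 2) (ha : -Real.pi ≤ a) (hab : a ≤ b) (hb : b ≤ Real.pi) :
    ENNReal.ofReal (2 ^ (-|β|) / 4 * δ ^ (β + 1) * (b - a)) ≤
      bergmanMeasure β (sector τ δ a b) := by
  have hm := measurableSet_sector τ δ a b
  have hsub : Set.Ioo (1 - δ) (1 - δ / 2) ⊆ Set.Ioo 0 1 :=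
    Set.Ioo_subset_Ioo (by linarith) (by linarith)
  have hrad : ∀ r ∈ Set.Ioo (1 - δ) (1 - δ / 2),
      ENNReal.ofReal (2 ^ (-|β|) / 2 * δ ^ β * (b - a)) ≤
        ENNReal.ofReal (r * (1 - r ^ 2) ^ β) * circleMeasure r (sector τ δ a b) := by
    intro r hr
    have hw : 2 ^ (-|β|) / 2 * δ ^ β ≤ r * (1 - r ^ 2) ^ β := by
      have hx1 : 1 / 2 ≤ (1 - r ^ 2) / δ := by
        rw [le_div_iff₀ hδ0]; nlinarith [hr.1, hr.2]
      have hx2 : (1 - r ^ 2) / δ ≤ 2 := by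
        rw [div_le_iff₀ hδ0]; nlinarith [hr.1, hr.2]
      have h := two_rpow_neg_abs_le (β := β) hx1 hx2
      have hpos : 0 ≤ 1 - r ^ 2 := by nlinarith [hr.1, hr.2]
      rw [Real.div_rpow hpos hδ0.le, le_div_iff₀ (Real.rpow_pos_of_pos hδ0 _)] at h
      have h0 : 0 ≤ (2 : ℝ) ^ (-|β|) * δ ^ β := by positivity
      nlinarith [hr.1]
    rw [ENNReal.ofReal_mul (by positivity)]
    exact mul_le_mul' (ENNReal.ofReal_le_ofReal hw)
      (le_circleMeasure_sector τ (hsub hr).1 hr ha hb)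
  rw [← lintegral_indicator_one hm, lintegral_bergmanMeasure β (measurable_one.indicator hm)]
  simp only [lintegral_indicator_one hm]
  refine le_trans ?_ (lintegral_mono_set hsub)
  refine le_trans ?_ (setLIntegral_mono_ae' measurableSet_Ioo (Filter.Eventually.of_forall hrad))
  rw [setLIntegral_const, Real.volume_Ioo, ← ENNReal.ofReal_mul (by
    have : 0 ≤ b - a := by linarith
    positivity), Real.rpow_add_one hδ0.ne']
  apply ENNReal.ofReal_le_ofReal
  apply le_of_eq
  ring

/-- Tonelli: over each point of the second sector, the fibre contains a sector of angular width `2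
δ` about `h s`. The fibre bound does not depend on `s`, so `h` need not be measurable. -/
theorem le_lintegral_prod_of_curve (ν : Measure ℂ) [SFinite ν] {δ m a b : ℝ} {h : ℝ → ℝ}
    {τ₁ τ₂ : Circle} (hδ0 : 0 < δ) (hδ : δ ≤ 1 / 2)
    (hν : ∀ (τ : Circle) (a b : ℝ), -Real.pi ≤ a → a ≤ b → b ≤ Real.pi →
      ENNReal.ofReal (m * (b - a)) ≤ ν (sector τ δ a b))
    (ha : -Real.pi ≤ a) (hab : a ≤ b) (hb : b ≤ Real.pi)
    (hh : ∀ s ∈ Set.Ioo a b, |h s| ≤ Real.pi / 2)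
    {G : ℂ × ℂ → ℝ≥0∞} (hG : Measurable G) {M : ℝ≥0∞}
    (hM : ∀ s ∈ Set.Ioo a b, ∀ θ ∈ Set.Ioo (h s - δ) (h s + δ),
      ∀ r₁ ∈ Set.Ioo (1 - δ) 1, ∀ r₂ ∈ Set.Ioo (1 - δ) 1,
        M ≤ G (polarPoint τ₁ τ₂ r₁ θ r₂ s)) :
    M * ENNReal.ofReal (m * (2 * δ)) * ENNReal.ofReal (m * (b - a)) ≤
      ∫⁻ z, G z ∂ν.prod ν := by
  have hsub : Set.Ioo (1 - δ) (1 - δ / 2) ⊆ Set.Ioo (1 - δ) 1 :=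
    Set.Ioo_subset_Ioo_right (by linarith)
  have hpi := Real.pi_gt_three
  rw [lintegral_prod_symm _ hG.aemeasurable]
  have hinner : ∀ y ∈ sector τ₂ δ a b,
      M * ENNReal.ofReal (m * (2 * δ)) ≤ ∫⁻ x, G (x, y) ∂ν := by
    intro y hy
    obtain ⟨r₂, hr₂, s, hs, rfl⟩ := exists_polar_of_mem_sector hy
    -- The window stays inside `[-π, π]`, since `π / 2 + 1 / 2 < π`.
    have hhs := abs_le.1 (hh s hs)
    calc M * ENNReal.ofReal (m * (2 * δ)) ≤ M * ν (sector τ₁ δ (h s - δ) (h s + δ)) := by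
          gcongr
          convert! hν τ₁ (h s - δ) (h s + δ) (by linarith) (by linarith) (by linarith) using 3
          ring
      _ = ∫⁻ x in sector τ₁ δ (h s - δ) (h s + δ), M ∂ν := by rw [setLIntegral_const]
      _ ≤ ∫⁻ x in sector τ₁ δ (h s - δ) (h s + δ),
            G (x, τ₂ * (r₂ * Complex.exp (s * Complex.I))) ∂ν := by
          refine setLIntegral_mono' (measurableSet_sector _ _ _ _) fun x hx => ?_
          obtain ⟨r₁, hr₁, θ, hθ, rfl⟩ := exists_polar_of_mem_sector hx
          exact hM s hs θ hθ r₁ (hsub hr₁) r₂ (hsub hr₂)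
      _ ≤ _ := setLIntegral_le_lintegral _ _
  calc M * ENNReal.ofReal (m * (2 * δ)) * ENNReal.ofReal (m * (b - a))
      ≤ M * ENNReal.ofReal (m * (2 * δ)) * ν (sector τ₂ δ a b) := by
        gcongr
        exact hν τ₂ a b ha hab hb
    _ = ∫⁻ _ in sector τ₂ δ a b, M * ENNReal.ofReal (m * (2 * δ)) ∂ν := by rw [setLIntegral_const]
    _ ≤ ∫⁻ y in sector τ₂ δ a b, ∫⁻ x, G (x, y) ∂ν ∂ν :=
        setLIntegral_mono' (measurableSet_sector _ _ _ _) hinner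
    _ ≤ _ := setLIntegral_le_lintegral _ _

/-- The norm of a function which is large near a curve in the torus. -/
theorem le_normSq_of_curve {β : ℝ} {δ a b : ℝ} {h : ℝ → ℝ}
    {τ₁ τ₂ : Circle} (hδ0 : 0 < δ) (hδ : δ ≤ 1 / 2)
    (ha : -Real.pi ≤ a) (hab : a ≤ b) (hb : b ≤ Real.pi)
    (hh : ∀ s ∈ Set.Ioo a b, |h s| ≤ Real.pi / 2)
    {F : ℂ × ℂ → ℂ} (hF : Measurable F) {M : ℝ≥0∞}
    (hM : ∀ s ∈ Set.Ioo a b, ∀ θ ∈ Set.Ioo (h s - δ) (h s + δ),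
      ∀ r₁ ∈ Set.Ioo (1 - δ) 1, ∀ r₂ ∈ Set.Ioo (1 - δ) 1,
        M ≤ ‖F (polarPoint τ₁ τ₂ r₁ θ r₂ s)‖ₑ ^ 2) :
    ENNReal.ofReal (1 / (2 * Real.pi) ^ 2) *
      (M * ENNReal.ofReal (2 ^ (-|β|) / 4 * δ ^ (β + 1) * (2 * δ)) *
        ENNReal.ofReal (2 ^ (-|β|) / 4 * δ ^ (β + 1) * (b - a))) ≤ normSq β F := by
  by_cases hβ : β = -1
  · subst hβ
    rw [normSq_eq_hardy hF]
    -- A single circle of the supremum suffices: this radius is the midpoint of `(1 - δ, 1 - δ /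
    -- 2)`.
    have hr : 1 - 3 * δ / 4 ∈ Set.Ioo (0 : ℝ) 1 := ⟨by linarith, by linarith⟩
    refine le_trans ?_ (le_iSup₂ (f := fun (r : ℝ) (_ : r ∈ Set.Ioo (0 : ℝ) 1) =>
      ENNReal.ofReal (1 / (2 * Real.pi) ^ 2) *
      ∫⁻ z, ‖F z‖ₑ ^ 2 ∂(circleMeasure r).prod (circleMeasure r)) (1 - 3 * δ / 4) hr)
    refine mul_le_mul_right (le_lintegral_prod_of_curve _ hδ0 hδ
      (fun τ a' b' ha' hab' hb' => ?_) ha hab hb hh (by fun_prop) hM) _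
    refine le_trans (ENNReal.ofReal_le_ofReal ?_)
      (le_circleMeasure_sector τ hr.1 ⟨by linarith, by linarith⟩ ha' hb')
    have h1 : (2 : ℝ) ^ (-|(-1 : ℝ)|) / 4 * δ ^ ((-1 : ℝ) + 1) = 1 / 8 := by
      rw [neg_add_cancel, Real.rpow_zero, abs_neg, abs_one, Real.rpow_neg_one]; norm_num
    rw [h1]
    linarith
  · rw [normSq_eq_bergman hβ hF]
    refine mul_le_mul' (ENNReal.ofReal_le_ofReal ?_) (le_lintegral_prod_of_curve _ hδ0 hδ
      (fun τ a' b' ha' hab' hb' => le_bergmanMeasure_sector β τ hδ0 hδ ha' hab' hb')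
      ha hab hb hh (by fun_prop) hM)
    have := Real.pi_pos
    gcongr
    linarith

theorem normSq_comp_swap (β : ℝ) {F : ℂ × ℂ → ℂ} (hF : Measurable F) :
    normSq β (F ∘ Prod.swap) = normSq β F := by
  have key : ∀ (ν : Measure ℂ) [SFinite ν],
      ∫⁻ z, ‖(F ∘ Prod.swap) z‖ₑ ^ 2 ∂ν.prod ν = ∫⁻ z, ‖F z‖ₑ ^ 2 ∂ν.prod ν := fun ν _ =>
    lintegral_prod_swap (fun z => ‖F z‖ₑ ^ 2)
  by_cases hβ : β = -1
  · subst hβ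
    rw [normSq_eq_hardy hF, normSq_eq_hardy (hF.comp measurable_swap)]
    simp only [key]
  · rw [normSq_eq_bergman hβ hF, normSq_eq_bergman hβ (hF.comp measurable_swap), key]

/-! ### Test functions -/

/-- The function `(1 - ρ ᾱ z)⁻ˢ`, peaking at `α`. -/
def peak (s : ℕ) (ρ : ℝ) (α : Circle) (z : ℂ) : ℂ := ((1 - ρ * ((α⁻¹ : Circle) * z)) ^ s)⁻¹

theorem measurable_peak (s : ℕ) (ρ : ℝ) (α : Circle) : Measurable (peak s ρ α) := by
  unfold peak
  fun_prop

theorem norm_one_sub_ge {δ r : ℝ} (hδ1 : δ < 1) (hr0 : 0 ≤ r) (θ : ℝ) :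
    1 - (1 - δ) * r ≤ ‖1 - ((1 - δ : ℝ) : ℂ) * (r * Complex.exp (θ * Complex.I))‖ := by
  have h := norm_sub_norm_le (1 : ℂ) (((1 - δ : ℝ) : ℂ) * (r * Complex.exp (θ * Complex.I)))
  rwa [norm_one, norm_mul, norm_mul, Complex.norm_exp_ofReal_mul_I, mul_one, Complex.norm_real,
    Complex.norm_real, Real.norm_of_nonneg (by linarith), Real.norm_of_nonneg hr0] at h

/-- From `cos θ ≤ 1 - θ² / 5` the squared modulus is at least `(1 - a)² + (2 / 5) a θ²`. For `a ≥
1/2` the second term suffices; for `a ≤ 1/2` the first is at least `1/4`, while `θ² / 49 ≤ 10 / 49`.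
-/
theorem abs_div_seven_le_norm_one_sub {a θ : ℝ} (ha0 : 0 ≤ a) (hθ : |θ| ≤ Real.pi) :
    |θ| / 7 ≤ ‖1 - (a : ℂ) * Complex.exp (θ * Complex.I)‖ := by
  have hsq : ‖1 - (a : ℂ) * Complex.exp (θ * Complex.I)‖ ^ 2 =
      1 - 2 * a * Real.cos θ + a ^ 2 := by
    rw [Complex.sq_norm, Complex.normSq_apply, Complex.exp_mul_I]
    simp only [Complex.sub_re, Complex.one_re, Complex.mul_re, Complex.ofReal_re, Complex.add_re,
      Complex.cos_ofReal_re, Complex.sin_ofReal_re, Complex.I_re, mul_zero, Complex.sin_ofReal_im,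
      Complex.I_im, mul_one, sub_self, add_zero, Complex.ofReal_im, Complex.add_im,
      Complex.cos_ofReal_im, Complex.mul_im, zero_add, zero_mul, sub_zero, Complex.sub_im,
      Complex.one_im]
    nlinarith [Real.sin_sq_add_cos_sq θ]
  rw [← sq_le_sq₀ (by positivity) (norm_nonneg _), hsq, div_pow, sq_abs]
  have hcos := Real.cos_le_one_sub_mul_cos_sq hθ
  have hθ2 : θ ^ 2 ≤ 10 := by
    have h1 := Real.pi_lt_d2
    have h2 := abs_le.1 hθ
    nlinarith
  have hpi : 2 / 10 ≤ 2 / Real.pi ^ 2 := by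
    have h1 := Real.pi_lt_d2
    have h2 := Real.pi_gt_three
    gcongr
    nlinarith
  have hcos' : Real.cos θ ≤ 1 - 2 / 10 * θ ^ 2 := by nlinarith [sq_nonneg θ]
  have h3 : 2 * a * Real.cos θ ≤ 2 * a * (1 - 2 / 10 * θ ^ 2) := by gcongr
  rcases le_total a (1 / 2) with h | h
  · nlinarith [mul_nonneg ha0 (sq_nonneg θ)]
  · nlinarith [sq_nonneg (1 - a), mul_le_mul_of_nonneg_right h (sq_nonneg θ)]

/-- Of the `2 s` factors `1 / A`, half are bounded through the radius and half through the angle,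
which separates the variables. The constant is `16 = 2 · 8`, where `8 A ≥ δ + |θ|` adds `A ≥ δ` and
`7 A ≥ |θ|`. -/
theorem sq_enorm_peak_le (s : ℕ) (α : Circle) {δ r θ : ℝ} (hδ0 : 0 < δ) (hδ1 : δ < 1)
    (hr0 : 0 ≤ r) (hr1 : r ≤ 1) (hθ : |θ| ≤ Real.pi) :
    ‖peak s (1 - δ) α (α * (r * Complex.exp (θ * Complex.I)))‖ₑ ^ 2 ≤
      ENNReal.ofReal (16 ^ s * ((δ + (1 - r)) ^ s)⁻¹) * ENNReal.ofReal (((δ + |θ|) ^ s)⁻¹) := by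
  set A := ‖1 - ((1 - δ : ℝ) : ℂ) * (r * Complex.exp (θ * Complex.I))‖ with hA
  have h1 : (δ + (1 - r)) / 2 ≤ A := by
    refine le_trans ?_ (norm_one_sub_ge hδ1 hr0 θ)
    nlinarith
  have h2 : (δ + |θ|) / 8 ≤ A := by
    have h3 : δ ≤ A := by
      refine le_trans ?_ (norm_one_sub_ge hδ1 hr0 θ)
      nlinarith
    have h4 : |θ| / 7 ≤ A := by
      have := abs_div_seven_le_norm_one_sub (a := (1 - δ) * r) (by nlinarith) hθ
      rwa [Complex.ofReal_mul, mul_assoc, ← hA] at this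
    linarith
  have p1 : 0 < δ + (1 - r) := by linarith
  have p2 : 0 < δ + |θ| := by positivity
  have hA0 : 0 < A := lt_of_lt_of_le (by positivity) h1
  have hnorm : ‖peak s (1 - δ) α (α * (r * Complex.exp (θ * Complex.I)))‖ₑ ^ 2 =
      ENNReal.ofReal ((A ^ s * A ^ s)⁻¹) := by
    rw [← ofReal_norm, ← ENNReal.ofReal_pow (norm_nonneg _), peak,
      ← mul_assoc ((α⁻¹ : Circle) : ℂ), ← Circle.coe_mul, inv_mul_cancel, Circle.coe_one, one_mul,
      norm_inv, norm_pow, ← hA, inv_pow, sq]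
  rw [hnorm, ← ENNReal.ofReal_mul (by positivity)]
  apply ENNReal.ofReal_le_ofReal
  calc (A ^ s * A ^ s)⁻¹ ≤ (((δ + (1 - r)) / 2) ^ s * ((δ + |θ|) / 8) ^ s)⁻¹ := by gcongr
    _ = 16 ^ s * ((δ + (1 - r)) ^ s)⁻¹ * ((δ + |θ|) ^ s)⁻¹ := by
      rw [div_pow, div_pow, show (16 : ℝ) = 2 * 8 by norm_num, mul_pow]
      field_simp

/-! ### Scaling of the model integrals and the resulting peak estimates. -/

theorem lintegral_eq_ofReal_mul_lintegral_comp_mul {δ : ℝ} (hδ : 0 < δ) {f : ℝ → ℝ≥0∞}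
    (hf : Measurable f) : ∫⁻ x, f x = ENNReal.ofReal δ * ∫⁻ y, f (δ * y) := by
  rw [← lintegral_map hf (measurable_const_mul δ), Real.map_volume_mul_left hδ.ne',
    lintegral_smul_measure, smul_eq_mul, ← mul_assoc, abs_of_pos (inv_pos.2 hδ),
    ← ENNReal.ofReal_mul hδ.le, mul_inv_cancel₀ hδ.ne', ENNReal.ofReal_one, one_mul]

/-- The integral of `(1 + |θ|)⁻ˢ` over the line. -/
def lineIntegral (s : ℕ) : ℝ≥0∞ := ∫⁻ θ : ℝ, ENNReal.ofReal (((1 + |θ|) ^ s)⁻¹)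

theorem lineIntegral_lt_top {s : ℕ} (hs : 2 ≤ s) : lineIntegral s < ∞ := by
  have h := integrable_one_add_norm (E := ℝ) (μ := volume) (r := s) (by
    rw [Module.finrank_self]
    have : (2 : ℝ) ≤ s := by exact_mod_cast hs
    push_cast
    linarith)
  refine lt_of_le_of_lt (lintegral_mono fun θ => ?_) h.lintegral_lt_top
  rw [Real.rpow_neg (by positivity), Real.rpow_natCast, Real.norm_eq_abs]

theorem lintegral_inv_add_abs_pow (s : ℕ) {δ : ℝ} (hδ : 0 < δ) :
    ∫⁻ θ : ℝ, ENNReal.ofReal (((δ + |θ|) ^ s)⁻¹) =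
      ENNReal.ofReal (δ * (δ ^ s)⁻¹) * lineIntegral s := by
  rw [lintegral_eq_ofReal_mul_lintegral_comp_mul hδ (by fun_prop), ENNReal.ofReal_mul hδ.le,
    mul_assoc, lineIntegral, ← lintegral_const_mul (ENNReal.ofReal (δ ^ s)⁻¹) (by fun_prop)]
  congr 1
  refine lintegral_congr fun y => ?_
  rw [← ENNReal.ofReal_mul (by positivity), abs_mul, abs_of_pos hδ,
    show δ + δ * |y| = δ * (1 + |y|) by ring, mul_pow, mul_inv]

theorem lintegral_peak_circleMeasure_le (s : ℕ) (α : Circle) {δ r : ℝ} (hδ0 : 0 < δ) (hδ1 : δ < 1)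
    (hr0 : 0 ≤ r) (hr1 : r ≤ 1) :
    ∫⁻ z, ‖peak s (1 - δ) α z‖ₑ ^ 2 ∂circleMeasure r ≤
      ENNReal.ofReal (16 ^ s * ((δ + (1 - r)) ^ s)⁻¹) *
        (ENNReal.ofReal (δ * (δ ^ s)⁻¹) * lineIntegral s) := by
  have hm := measurable_peak s (1 - δ) α
  rw [lintegral_circleMeasure α r (by fun_prop), ← lintegral_inv_add_abs_pow s hδ0,
    ← lintegral_const_mul _ (by fun_prop)]
  refine (setLIntegral_mono' measurableSet_Ioc fun θ hθ => ?_).trans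
    (setLIntegral_le_lintegral _ _)
  exact sq_enorm_peak_le s α hδ0 hδ1 hr0 hr1 (abs_le.2 ⟨hθ.1.le, hθ.2⟩)

/-- The integral of `x^β (1 + x)⁻ˢ` over the half-line. -/
def halfLineIntegral (β : ℝ) (s : ℕ) : ℝ≥0∞ :=
  ∫⁻ x in Set.Ioi (0 : ℝ), ENNReal.ofReal (x ^ β * ((1 + x) ^ s)⁻¹)

theorem halfLineIntegral_lt_top {β : ℝ} (hβ : -1 < β) {s : ℕ} (hs : β + 1 < s) :
    halfLineIntegral β s < ∞ := by
  -- Convergence at `0` needs `β > -1`; convergence at infinity needs `s > β + 1`.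
  rw [halfLineIntegral, ← Set.Ioc_union_Ioi_eq_Ioi zero_le_one]
  refine (lintegral_union_le _ _ _).trans_lt (ENNReal.add_lt_top.2 ⟨?_, ?_⟩)
  · have h := (intervalIntegral.intervalIntegrable_rpow' (a := 0) (b := 1) hβ)
    rw [intervalIntegrable_iff_integrableOn_Ioc_of_le zero_le_one] at h
    refine lt_of_le_of_lt (setLIntegral_mono' measurableSet_Ioc fun x hx =>
      ENNReal.ofReal_le_ofReal ?_) h.lintegral_lt_top
    have h1 : 0 ≤ x ^ β := Real.rpow_nonneg hx.1.le _
    refine mul_le_of_le_one_right h1 (inv_le_one_of_one_le₀ (one_le_pow₀ ?_))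
    linarith [hx.1]
  · have h := integrableOn_Ioi_rpow_of_lt (a := β - s) (c := 1) (by linarith) one_pos
    refine lt_of_le_of_lt (setLIntegral_mono' measurableSet_Ioi fun x hx =>
      ENNReal.ofReal_le_ofReal ?_) h.lintegral_lt_top
    have hx0 : 0 < x := lt_trans one_pos hx
    rw [Real.rpow_sub hx0, Real.rpow_natCast, div_eq_mul_inv]
    gcongr
    linarith

theorem lintegral_rpow_mul_inv_add_pow (β : ℝ) (s : ℕ) {δ : ℝ} (hδ : 0 < δ) :
    ∫⁻ x in Set.Ioi (0 : ℝ), ENNReal.ofReal (x ^ β * ((δ + x) ^ s)⁻¹) =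
      ENNReal.ofReal (δ ^ (β + 1) * (δ ^ s)⁻¹) * halfLineIntegral β s := by
  rw [← lintegral_indicator measurableSet_Ioi,
    lintegral_eq_ofReal_mul_lintegral_comp_mul hδ
      (Measurable.indicator (by fun_prop) measurableSet_Ioi),
    halfLineIntegral, ← lintegral_indicator measurableSet_Ioi, Real.rpow_add_one hδ.ne',
    mul_comm (δ ^ β) δ, mul_assoc δ, ENNReal.ofReal_mul hδ.le, mul_assoc,
    ← lintegral_const_mul (ENNReal.ofReal (δ ^ β * (δ ^ s)⁻¹))
      (Measurable.indicator (by fun_prop) measurableSet_Ioi)]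
  congr 1
  refine lintegral_congr fun y => ?_
  by_cases hy : 0 < y
  · rw [Set.indicator_of_mem (show δ * y ∈ Set.Ioi 0 from mul_pos hδ hy),
      Set.indicator_of_mem (show y ∈ Set.Ioi 0 from hy),
      ← ENNReal.ofReal_mul (by positivity), Real.mul_rpow hδ.le hy.le,
      show δ + δ * y = δ * (1 + y) by ring, mul_pow, mul_inv]
    congr 1
    ring
  · rw [Set.indicator_of_notMem (show ¬ (δ * y ∈ Set.Ioi 0) by
        rw [Set.mem_Ioi, mul_pos_iff_of_pos_left hδ]; exact hy),
      Set.indicator_of_notMem (show ¬ (y ∈ Set.Ioi 0) from hy), mul_zero]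

/-- The circle estimates are integrated in `x = 1 - r`. The weight is at most `2^|β| x^β`, and the
range of `x` is enlarged to the half-line so that scaling by `δ` applies. -/
theorem lintegral_peak_bergmanMeasure_le (β : ℝ) (s : ℕ) (α : Circle) {δ : ℝ}
    (hδ0 : 0 < δ) (hδ1 : δ < 1) :
    ∫⁻ z, ‖peak s (1 - δ) α z‖ₑ ^ 2 ∂bergmanMeasure β ≤
      ENNReal.ofReal (16 ^ s * 2 ^ |β| * δ ^ (β + 1) * (δ ^ s)⁻¹) * halfLineIntegral β s *
        (ENNReal.ofReal (δ * (δ ^ s)⁻¹) * lineIntegral s) := by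
  have hm := measurable_peak s (1 - δ) α
  rw [lintegral_bergmanMeasure β (by fun_prop)]
  set J := ENNReal.ofReal (δ * (δ ^ s)⁻¹) * lineIntegral s with hJ
  have hpt : ∀ r ∈ Set.Ioo (0 : ℝ) 1, ENNReal.ofReal (r * (1 - r ^ 2) ^ β) *
      ∫⁻ z, ‖peak s (1 - δ) α z‖ₑ ^ 2 ∂circleMeasure r ≤
      (ENNReal.ofReal (16 ^ s * 2 ^ |β|) * J) * (Set.Ioi 0).indicator
        (fun x => ENNReal.ofReal (x ^ β * ((δ + x) ^ s)⁻¹)) (1 - r) := by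
    intro r hr
    have hr' : 0 < 1 - r := by linarith [hr.2]
    rw [Set.indicator_of_mem (show 1 - r ∈ Set.Ioi 0 from hr')]
    have hw : r * (1 - r ^ 2) ^ β ≤ 2 ^ |β| * (1 - r) ^ β := by
      have h := rpow_le_two_rpow_abs (β := β) (x := 1 + r) (by linarith [hr.1]) (by linarith [hr.2])
      have h0 : 0 ≤ (1 - r) ^ β := by positivity
      have h1 : (1 - r ^ 2) ^ β = (1 + r) ^ β * (1 - r) ^ β := by
        rw [← Real.mul_rpow (by linarith [hr.1]) hr'.le]
        congr 1; ring
      rw [h1]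
      have h2 : 0 ≤ (1 + r) ^ β := Real.rpow_nonneg (by linarith [hr.1]) _
      calc r * ((1 + r) ^ β * (1 - r) ^ β) ≤ 1 * ((1 + r) ^ β * (1 - r) ^ β) := by
            gcongr; exact hr.2.le
        _ ≤ _ := by rw [one_mul]; gcongr
    calc _ ≤ ENNReal.ofReal (2 ^ |β| * (1 - r) ^ β) *
          (ENNReal.ofReal (16 ^ s * ((δ + (1 - r)) ^ s)⁻¹) * J) := by
          gcongr
          exact lintegral_peak_circleMeasure_le s α hδ0 hδ1 hr.1.le hr.2.le
      _ = _ := by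
          rw [← mul_assoc, ← ENNReal.ofReal_mul (by positivity),
            mul_right_comm (ENNReal.ofReal _) J, ← ENNReal.ofReal_mul (by positivity)]
          congr 2
          ring
  refine (setLIntegral_mono' measurableSet_Ioo hpt).trans ((setLIntegral_le_lintegral _ _).trans ?_)
  have hind : Measurable ((Set.Ioi (0 : ℝ)).indicator
      (fun x => ENNReal.ofReal (x ^ β * ((δ + x) ^ s)⁻¹))) :=
    Measurable.indicator (by fun_prop) measurableSet_Ioi
  rw [lintegral_const_mul _ (by exact hind.comp (measurable_const.sub measurable_id)),
    lintegral_sub_left_eq_self _ (1 : ℝ), lintegral_indicator measurableSet_Ioi,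
    lintegral_rpow_mul_inv_add_pow β s hδ0, mul_right_comm,
    ← mul_assoc (ENNReal.ofReal (16 ^ s * 2 ^ |β|)),
    ← ENNReal.ofReal_mul (by positivity)]
  apply le_of_eq
  congr 3
  ring

/-- The product of two peak functions. -/
def biPeak (s : ℕ) (ρ : ℝ) (α₁ α₂ : Circle) (z : ℂ × ℂ) : ℂ := peak s ρ α₁ z.1 * peak s ρ α₂ z.2

theorem measurable_biPeak (s : ℕ) (ρ : ℝ) (α₁ α₂ : Circle) : Measurable (biPeak s ρ α₁ α₂) :=
  ((measurable_peak s ρ α₁).comp measurable_fst).mul ((measurable_peak s ρ α₂).comp measurable_snd)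

theorem lintegral_biPeak (s : ℕ) (ρ : ℝ) (α₁ α₂ : Circle) (ν : Measure ℂ) [SFinite ν] :
    ∫⁻ z, ‖biPeak s ρ α₁ α₂ z‖ₑ ^ 2 ∂ν.prod ν =
      (∫⁻ z, ‖peak s ρ α₁ z‖ₑ ^ 2 ∂ν) * ∫⁻ z, ‖peak s ρ α₂ z‖ₑ ^ 2 ∂ν := by
  have h1 := measurable_peak s ρ α₁
  have h2 := measurable_peak s ρ α₂
  rw [← lintegral_prod_mul (by fun_prop) (by fun_prop)]
  refine lintegral_congr fun z => ?_
  rw [biPeak, enorm_mul, mul_pow]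

/-- The integral factors over the two variables. Taking `s ≥ 2` and `s > β + 1` makes the model
integrals finite, leaving only the powers of `δ`. -/
theorem exists_normSq_biPeak_le {β : ℝ} (hβ : -1 ≤ β) : ∃ s : ℕ, ∃ C : ℝ, 0 < C ∧
    ∀ δ ∈ Set.Ioo (0 : ℝ) 1, ∀ α₁ α₂ : Circle, normSq β (biPeak s (1 - δ) α₁ α₂) ≤
      ENNReal.ofReal (C * (δ ^ (β + 1) * δ * ((δ ^ s)⁻¹) ^ 2)) ^ 2 := by
  obtain ⟨s₀, hs₀⟩ := exists_nat_gt (β + 1)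
  set s := max s₀ 2 with hs
  have hs2 : 2 ≤ s := le_max_right _ _
  have hsβ : β + 1 < s := hs₀.trans_le (by exact_mod_cast le_max_left _ _)
  set J := (lineIntegral s).toReal with hJ
  have hJ' : lineIntegral s = ENNReal.ofReal J :=
    (ENNReal.ofReal_toReal (lineIntegral_lt_top hs2).ne).symm
  have hJ0 : 0 ≤ J := ENNReal.toReal_nonneg
  have hpi : ENNReal.ofReal (1 / Real.pi ^ 2) ≤ 1 := by
    rw [← ENNReal.ofReal_one]
    apply ENNReal.ofReal_le_ofReal
    rw [div_le_one (by positivity)]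
    nlinarith [Real.pi_gt_three]
  have hpi' : ENNReal.ofReal (1 / (2 * Real.pi) ^ 2) ≤ 1 := by
    rw [← ENNReal.ofReal_one]
    apply ENNReal.ofReal_le_ofReal
    rw [div_le_one (by positivity)]
    nlinarith [Real.pi_gt_three]
  rcases eq_or_lt_of_le hβ with rfl | hβ'
  · refine ⟨s, 16 ^ s * J + 1, by positivity, fun δ hδ α₁ α₂ => ?_⟩
    have hδ0 := hδ.1
    rw [normSq_eq_hardy (measurable_biPeak _ _ _ _)]
    refine iSup₂_le fun r hr => ?_
    have hb : ∀ α : Circle, ∫⁻ z, ‖peak s (1 - δ) α z‖ₑ ^ 2 ∂circleMeasure r ≤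
        ENNReal.ofReal ((16 ^ s * J + 1) * (δ ^ ((-1 : ℝ) + 1) * δ * ((δ ^ s)⁻¹) ^ 2)) := by
      intro α
      refine (lintegral_peak_circleMeasure_le s α hδ.1 hδ.2 hr.1.le hr.2.le).trans ?_
      have : 0 ≤ 1 - r := by linarith [hr.2]
      rw [hJ', ← ENNReal.ofReal_mul (by positivity), ← ENNReal.ofReal_mul (by positivity)]
      apply ENNReal.ofReal_le_ofReal
      rw [neg_add_cancel, Real.rpow_zero, one_mul]
      -- Uniform in `r`: the radial factor is bounded by its value at `r = 1`.
      calc _ ≤ 16 ^ s * (δ ^ s)⁻¹ * (δ * (δ ^ s)⁻¹ * J) := by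
            gcongr
            linarith
        _ = (16 ^ s * J) * (δ * ((δ ^ s)⁻¹) ^ 2) := by ring
        _ ≤ _ := by gcongr; linarith
    rw [lintegral_biPeak, sq (ENNReal.ofReal _)]
    exact (mul_le_mul' hpi' (mul_le_mul' (hb α₁) (hb α₂))).trans_eq (one_mul _)
  · set K := (halfLineIntegral β s).toReal with hK
    have hK' : halfLineIntegral β s = ENNReal.ofReal K :=
      (ENNReal.ofReal_toReal (halfLineIntegral_lt_top hβ' hsβ).ne).symm
    have hK0 : 0 ≤ K := ENNReal.toReal_nonneg
    refine ⟨s, 16 ^ s * 2 ^ |β| * J * K + 1, by positivity, fun δ hδ α₁ α₂ => ?_⟩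
    have hδ0 := hδ.1
    rw [normSq_eq_bergman hβ'.ne' (measurable_biPeak _ _ _ _)]
    have hb : ∀ α : Circle, ∫⁻ z, ‖peak s (1 - δ) α z‖ₑ ^ 2 ∂bergmanMeasure β ≤
        ENNReal.ofReal ((16 ^ s * 2 ^ |β| * J * K + 1) *
          (δ ^ (β + 1) * δ * ((δ ^ s)⁻¹) ^ 2)) := by
      intro α
      refine (lintegral_peak_bergmanMeasure_le β s α hδ.1 hδ.2).trans ?_
      rw [hJ', hK', ← ENNReal.ofReal_mul (by positivity), ← ENNReal.ofReal_mul (by positivity),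
        ← ENNReal.ofReal_mul (by positivity)]
      apply ENNReal.ofReal_le_ofReal
      calc _ = (16 ^ s * 2 ^ |β| * J * K) * (δ ^ (β + 1) * δ * ((δ ^ s)⁻¹) ^ 2) := by ring
        _ ≤ _ := by gcongr; linarith
    rw [lintegral_biPeak, sq (ENNReal.ofReal _)]
    exact (mul_le_mul' hpi (mul_le_mul' (hb α₁) (hb α₂))).trans_eq (one_mul _)

/-! ### Unboundedness of the composition operator -/

theorem le_norm_peak (s : ℕ) (α : Circle) {δ L : ℝ} (hδ0 : 0 < δ) (hδ1 : δ < 1) {v : ℂ}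
    (hv : ‖v‖ < 1) (hvα : ‖v - α‖ ≤ L * δ) :
    ((((L + 1) * δ) ^ s)⁻¹) ≤ ‖peak s (1 - δ) α v‖ := by
  have hnorm : ‖((1 - δ : ℝ) : ℂ)‖ = 1 - δ := by
    rw [Complex.norm_real, Real.norm_of_nonneg (by linarith)]
  -- Nonvanishing is essential, because the inverse of `0` is `0`.
  have hpos : 0 < ‖1 - ((1 - δ : ℝ) : ℂ) * ((α⁻¹ : Circle) * v)‖ := by
    have h := norm_sub_norm_le (1 : ℂ) (((1 - δ : ℝ) : ℂ) * ((α⁻¹ : Circle) * v))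
    rw [norm_one, norm_mul, norm_mul, Circle.norm_coe, one_mul, hnorm] at h
    nlinarith [norm_nonneg v]
  have hle : ‖1 - ((1 - δ : ℝ) : ℂ) * ((α⁻¹ : Circle) * v)‖ ≤ (L + 1) * δ := by
    have hα : ((α⁻¹ : Circle) : ℂ) * α = 1 := by
      rw [← Circle.coe_mul, inv_mul_cancel, Circle.coe_one]
    have e : 1 - ((1 - δ : ℝ) : ℂ) * ((α⁻¹ : Circle) * v) =
        (δ : ℂ) - ((1 - δ : ℝ) : ℂ) * ((α⁻¹ : Circle) * (v - α)) := by
      rw [Complex.ofReal_sub, Complex.ofReal_one]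
      linear_combination ((δ : ℂ) - 1) * hα
    rw [e]
    refine (norm_sub_le _ _).trans ?_
    rw [norm_mul, norm_mul, Circle.norm_coe, one_mul, hnorm, Complex.norm_real,
      Real.norm_of_nonneg hδ0.le]
    nlinarith [norm_nonneg (v - α)]
  rw [peak, norm_inv, norm_pow]
  gcongr

theorem differentiableOn_biPeak (s : ℕ) {δ : ℝ} (hδ0 : 0 < δ) (hδ1 : δ < 1) (α₁ α₂ : Circle) :
    DifferentiableOn ℂ (biPeak s (1 - δ) α₁ α₂) bidisc := by
  have key : ∀ α : Circle, ∀ z : ℂ, ‖z‖ < 1 → DifferentiableAt ℂ (peak s (1 - δ) α) z := by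
    intro α z hz
    have hne : (1 - ((1 - δ : ℝ) : ℂ) * ((α⁻¹ : Circle) * z)) ^ s ≠ 0 := by
      apply pow_ne_zero
      intro h
      have h' : ‖((1 - δ : ℝ) : ℂ) * ((α⁻¹ : Circle) * z)‖ = 1 := by
        rw [← sub_eq_zero.1 h, norm_one]
      rw [norm_mul, norm_mul, Circle.norm_coe, one_mul, Complex.norm_real,
        Real.norm_of_nonneg (by linarith)] at h'
      nlinarith [norm_nonneg z]
    unfold peak
    exact DifferentiableAt.inv (by fun_prop) hne
  intro z hz
  exact (((key α₁ z.1 hz.1).comp z differentiableAt_fst).mul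
    ((key α₂ z.2 hz.2).comp z differentiableAt_snd)).differentiableWithinAt

theorem polarPoint_mem_bidisc {τ₁ τ₂ : Circle} {r₁ r₂ θ₁ θ₂ : ℝ} (h₁ : r₁ ∈ Set.Ioo 0 1)
    (h₂ : r₂ ∈ Set.Ioo 0 1) : polarPoint τ₁ τ₂ r₁ θ₁ r₂ θ₂ ∈ bidisc := by
  refine ⟨?_, ?_⟩ <;>
  simp only [polarPoint, norm_mul, Circle.norm_coe, one_mul, Complex.norm_exp_ofReal_mul_I,
    mul_one, Complex.norm_real]
  · rw [Real.norm_of_nonneg h₁.1.le]; exact h₁.2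
  · rw [Real.norm_of_nonneg h₂.1.le]; exact h₂.2

/-- Composition with a map that is nearly constant along a curve in the torus is not bounded. -/
theorem exists_normSq_comp_gt {β : ℝ} (hβ : -1 ≤ β) {τ₁ τ₂ α₁ α₂ : Circle} {φ₁ φ₂ : ℂ × ℂ → ℂ}
    (hm₁ : Measurable φ₁) (hm₂ : Measurable φ₂) (h₁ : ∀ z ∈ bidisc, ‖φ₁ z‖ < 1)
    (h₂ : ∀ z ∈ bidisc, ‖φ₂ z‖ < 1) (h : NearlyConstantAlongCurve τ₁ τ₂ α₁ α₂ φ₁ φ₂) {B : ℝ}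
    (hB : 0 ≤ B) : ∃ f ∈ bergmanSpace β, Measurable f ∧
      ENNReal.ofReal B * normSq β f < normSq β (f ∘ fun z => (φ₁ z, φ₂ z)) := by
  obtain ⟨s, C, hC, hup⟩ := exists_normSq_biPeak_le hβ
  obtain ⟨L, δ₀, a, b, h, hL, hδ₀, hδ₀', ha, hab, hb, hh, hest⟩ := h
  have hpi := Real.pi_pos
  have hab' : 0 < b - a := sub_pos.2 hab
  set c : ℝ := 2 ^ (-|β|) / 4 with hc
  have hc0 : 0 < c := by positivity
  -- `A` collects the factors of the lower bound free of `δ`. With `X = δ^(2β + 3 - 4s)` the lower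
  -- bound is `A X`, and `B` times the squared upper bound is `B C² δ X`; hence the choice of `δ`.
  set A : ℝ := 1 / (2 * Real.pi) ^ 2 * (((L + 1) ^ s)⁻¹) ^ 4 * (2 * c ^ 2 * (b - a)) with hA
  have hA0 : 0 < A := by positivity
  obtain ⟨δ, hδ0, hδ⟩ := exists_between (lt_min hδ₀ (show 0 < A / (B * C ^ 2 + 1) by positivity))
  have hδ1 : δ < δ₀ := hδ.trans_le (min_le_left _ _)
  have hδ2 : (B * C ^ 2) * δ < A := by
    have := hδ.trans_le (min_le_right _ _)
    rw [lt_div_iff₀ (by positivity)] at this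
    nlinarith
  have hδ3 : δ ∈ Set.Ioo (0 : ℝ) 1 := ⟨hδ0, by linarith⟩
  have hfin := hup δ hδ3 α₁ α₂
  refine ⟨biPeak s (1 - δ) α₁ α₂, ⟨differentiableOn_biPeak s hδ0 hδ3.2 α₁ α₂, ?_⟩,
    measurable_biPeak _ _ _ _, ?_⟩
  · exact ENNReal.rpow_lt_top_of_nonneg (by norm_num)
      (hfin.trans_lt (ENNReal.pow_lt_top ENNReal.ofReal_lt_top)).ne
  have hlow := le_normSq_of_curve (β := β) (τ₁ := τ₁) (τ₂ := τ₂) hδ0 (by linarith) ha hab.le hb hh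
    (F := biPeak s (1 - δ) α₁ α₂ ∘ fun z => (φ₁ z, φ₂ z))
    ((measurable_biPeak _ _ _ _).comp (hm₁.prodMk hm₂))
    (M := ENNReal.ofReal (((((L + 1) * δ) ^ s)⁻¹) ^ 4)) (by
      intro t ht θ hθ r₁ hr₁ r₂ hr₂
      have hmem : polarPoint τ₁ τ₂ r₁ θ r₂ t ∈ bidisc :=
        polarPoint_mem_bidisc ⟨by linarith [hr₁.1], hr₁.2⟩ ⟨by linarith [hr₂.1], hr₂.2⟩
      obtain ⟨e₁, e₂⟩ := hest δ ⟨hδ0, hδ1⟩ t ht θ hθ r₁ hr₁ r₂ hr₂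
      have k₁ := le_norm_peak s α₁ hδ0 hδ3.2 (h₁ _ hmem) e₁
      have k₂ := le_norm_peak s α₂ hδ0 hδ3.2 (h₂ _ hmem) e₂
      rw [← ofReal_norm, ← ENNReal.ofReal_pow (norm_nonneg _)]
      apply ENNReal.ofReal_le_ofReal
      rw [Function.comp_apply, biPeak, norm_mul]
      calc ((((L + 1) * δ) ^ s)⁻¹) ^ 4
          = (((((L + 1) * δ) ^ s)⁻¹) * ((((L + 1) * δ) ^ s)⁻¹)) ^ 2 := by ring
        _ ≤ _ := by gcongr)
  refine lt_of_le_of_lt (mul_le_mul_right hfin _) (lt_of_lt_of_le ?_ hlow)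
  rw [← hc, ← ENNReal.ofReal_pow (by positivity), ← ENNReal.ofReal_mul hB,
    ← ENNReal.ofReal_mul (by positivity), ← ENNReal.ofReal_mul (by positivity),
    ← ENNReal.ofReal_mul (by positivity)]
  have hX : 0 < δ * (δ ^ (β + 1)) ^ 2 * ((δ ^ s)⁻¹) ^ 4 := by positivity
  have hlt := mul_lt_mul_of_pos_right hδ2 hX
  have e1 : B * (C * (δ ^ (β + 1) * δ * ((δ ^ s)⁻¹) ^ 2)) ^ 2 =
      B * C ^ 2 * δ * (δ * (δ ^ (β + 1)) ^ 2 * ((δ ^ s)⁻¹) ^ 4) := by ring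
  have e2 : 1 / (2 * Real.pi) ^ 2 * (((((L + 1) * δ) ^ s)⁻¹) ^ 4 * (c * δ ^ (β + 1) * (2 * δ)) *
      (c * δ ^ (β + 1) * (b - a))) = A * (δ * (δ ^ (β + 1)) ^ 2 * ((δ ^ s)⁻¹) ^ 4) := by
    rw [hA, mul_pow (L + 1) δ s, mul_inv]
    ring
  rw [e1, e2]
  exact (ENNReal.ofReal_lt_ofReal_iff (by positivity)).2 hlt

theorem CompositionBounded.exists_normSq_comp_le {β : ℝ} {Φ : ℂ × ℂ → ℂ × ℂ}
    (h : CompositionBounded β Φ) : ∃ B : ℝ, 0 ≤ B ∧ ∀ f ∈ bergmanSpace β,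
      normSq β (f ∘ Φ) ≤ ENNReal.ofReal B * normSq β f := by
  obtain ⟨C, hC⟩ := h
  refine ⟨(C : ℝ) ^ 2, by positivity, fun f hf => ?_⟩
  have hsq : ∀ g, norm β g ^ 2 = normSq β g := by
    intro g
    rw [norm, ← ENNReal.rpow_natCast, ← ENNReal.rpow_mul]
    norm_num
  have := pow_le_pow_left₀ zero_le (hC f hf).2 2
  rwa [mul_pow, hsq, hsq, ← ENNReal.ofReal_coe_nnreal,
    ← ENNReal.ofReal_pow C.coe_nonneg] at this

theorem measurable_rif (p : MvPolynomial (Fin 2) ℂ) : Measurable (rif p) :=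
  (continuous_evalAt (reflection p)).measurable.div (continuous_evalAt p).measurable

/-! ### Zeros given by a branch or by the line factor. -/

theorem WPExpansion.eventually_branch {F : MvPolynomial (Fin 2) ℂ} {N : ℕ} (E : WPExpansion F N)
    (i : Fin E.n) : ∀ᶠ t in 𝓝 (0 : ℂ), evalAt F (-E.g i t, t ^ N) = 0 := by
  have hc : Filter.Tendsto (fun t : ℂ => ((-E.g i t, t) : ℂ × ℂ)) (𝓝 0) (𝓝 (0, 0)) := by
    have h1 := (E.g_analytic i).continuousAt.neg
    have h2 := h1.prodMk (continuousAt_id (x := (0 : ℂ)))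
    simpa [ContinuousAt, E.g_zero i] using h2
  filter_upwards [hc.eventually E.factorization] with t ht
  rw [ht, Finset.prod_eq_zero (Finset.mem_univ i) (by simp), mul_zero]

theorem WPExpansion.eventually_line {F : MvPolynomial (Fin 2) ℂ} {N : ℕ} (hN : 0 < N)
    (E : WPExpansion F N) (hk : 0 < E.k) : ∀ᶠ t in 𝓝 (0 : ℂ), evalAt F (t, 0) = 0 := by
  have hc : Filter.Tendsto (fun t : ℂ => ((t, 0) : ℂ × ℂ)) (𝓝 0) (𝓝 (0, 0)) :=
    Continuous.tendsto (by fun_prop) (0 : ℂ)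
  filter_upwards [hc.eventually E.factorization] with t ht
  simpa [hN.ne', hk.ne'] using ht

end RIFComposition

end

theorem corollary2p4 (p₁ p₂ : MvPolynomial (Fin 2) ℂ)
    (hp₁ : RIFComposition.InducesRIF p₁) (hp₂ : RIFComposition.InducesRIF p₂)
    (τ₁ τ₂ : Circle)
    (hshare : ∃ α₁ α₂ : Circle, RIFComposition.ShareWPFactor
      (RIFComposition.conjPoly (RIFComposition.cayley τ₁ τ₂ p₁) -
        MvPolynomial.C (α₁ : ℂ) * RIFComposition.cayley τ₁ τ₂ p₁)
      (RIFComposition.conjPoly (RIFComposition.cayley τ₁ τ₂ p₂) -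
        MvPolynomial.C (α₂ : ℂ) * RIFComposition.cayley τ₁ τ₂ p₂)) :
    ∀ β : ℝ, -1 ≤ β →
      ¬ RIFComposition.CompositionBounded β
        (fun z => (RIFComposition.rif p₁ z, RIFComposition.rif p₂ z)) := by
  open RIFComposition in
  intro β hβ hbdd
  obtain ⟨B, hB, hle⟩ := hbdd.exists_normSq_comp_le
  obtain ⟨α₁, α₂, N, hN, E₁, E₂, hE⟩ := hshare
  have hm₁ := measurable_rif p₁
  have hm₂ := measurable_rif p₂
  rcases hE with ⟨i, j, hij⟩ | ⟨hk₁, hk₂⟩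
  -- The branches agree as germs, so a single parametrised curve lies on both level sets.
  · have hcurve := nearlyConstantAlongCurve_of_branch hp₁ hp₂ τ₁ τ₂ α₁ α₂ hN (E₁.g_analytic i)
      (E₁.g_zero i) (E₁.eventually_branch i) (by
        filter_upwards [hij, E₂.eventually_branch j] with t h1 h2
        rw [h1]; exact h2)
    obtain ⟨f, hf, -, hlt⟩ := exists_normSq_comp_gt hβ hm₁ hm₂
      (fun z hz => hp₁.norm_rif_lt_one hz) (fun z hz => hp₂.norm_rif_lt_one hz) hcurve hB
    exact absurd (hle f hf) (not_le.2 hlt)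
  · have hcurve := nearlyConstantAlongCurve_of_line hp₁ hp₂ τ₁ τ₂ α₁ α₂
      (E₁.eventually_line hN hk₁) (E₂.eventually_line hN hk₂)
    obtain ⟨f, hf, hfm, hlt⟩ := exists_normSq_comp_gt hβ (hm₁.comp measurable_swap)
      (hm₂.comp measurable_swap) (fun z hz => hp₁.norm_rif_lt_one ⟨hz.2, hz.1⟩)
      (fun z hz => hp₂.norm_rif_lt_one ⟨hz.2, hz.1⟩) hcurve hB
    -- The test function was built for `Φ ∘ swap`. The weight is symmetric, so the norm of `f ∘ Φ`
    -- is unchanged by the swap.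
    have hswap := normSq_comp_swap β (hfm.comp (hm₁.prodMk hm₂))
    exact absurd ((hswap.trans_le (hle f hf))) (not_le.2 hlt)
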